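/- Model. A deterministic abstract data type consists of states, a nonempty set of initial states, invocations, return values and a transition map $\delta$ sending a state and an invocation to a return value and a new state. In a system of $n$ processes, an implementation of a type gives each process a program that keeps a local state between operations, performs arbitrary computable local computations, and accesses a countable family of shared objects; processes invoke operations repeatedly and their steps interleave arbitrarily. It is wait-free if in every (finite or infinite) execution every operation terminates unless the process performing it takes only finitely many steps. Let $H$ be a (finite or infinite) history of invocations and responses at an object of type $T$. A legal sequential history is a finite or infinite sequence of operations with responses, each operation occurring at most once, that obeys $\delta$ from some initial state. $H$ is weakly consistent if for each operation $o$ of a process $p$ with a response in $H$ there is a legal sequential history that contains only operations invoked in $H$ before $o$ returns, contains all operations of $p$ preceding $o$, and ends with $o$ with the same response as in $H$. A $t$-linearization of $H$ is a legal sequential history $S$ such that (1) every operation of $S$ is invoked in $H$; (2) every operation completed in $H$ is completed in $S$; (3) if the response of $o_1$ precedes the invocation of $o_2$, neither event is among the first $t$ events of $H$, and $o_2$ is in $S$, then $o_1$ precedes $o_2$ in $S$; (4) every operation whose response in $H$ is not among the first $t$ events has the same response in $S$. $H$ is linearizable if it has a $0$-linearization, and eventually linearizable if it is weakly consistent and has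 a $t$-linearization for some $t\ge 0$. An implementation is eventually linearizable if every history it produces is. The consensus data type $T_{\mathrm{cons}}$ over a countable set $V$ has one operation $\mathrm{propose}(v)$, which decides $v$ if nothing has been decided before, and returns the decided value. The fetch-and-cons (FAC) data type over a nonempty countable set $W$ has as state a list, initially empty; $\mathrm{fac}(v)$ adds $v$ at the head and returns the entire list stored before. The eventual consensus number $e_m^r(T)$ is the largest $n$ (or $\infty$) such that, in a system of $n$ processes, eventually linearizable objects of type $T$ together with linearizable read/write registers can wait-free implement an eventually linearizable FAC object. Theorem. The consensus data type has eventual consensus number $1$: $e_m^r(T_{\mathrm{cons}}) = 1$. Moreover, for every $n$, eventually linearizable consensus for $n$ processes can be implemented wait-free from finitely many linearizable registers. -/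

import Mathlib

/-! ## Abstract data types -/

/-- A deterministic abstract data type: a set of states, a nonempty set of possible initial states,
a set of invocations, a set of return values, and a transition map.  Invocations and return values
are handled by programs, so they come with a standard coding by natural numbers. -/
structure DataType where
  State : Type
  Inv : Type
  Res : Type
  [invCode : Primcodable Inv]
  [resCode : Primcodable Res]
  init : Set State
  init_nonempty : init.Nonempty
  δ : State → Inv → Res × State

attribute [instance] DataType.invCode DataType.resCode

namespace DataType

/-- The consensus type with proposals in `V`.  The state is the decided value, if there is one;
`propose v` decides `v` if nothing is decided yet, and returns the decided value. -/
def consensus (V : Type) [Primcodable V] : DataType where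
  State := Option V
  Inv := V
  Res := V
  init := {none}
  init_nonempty := Set.singleton_nonempty _
  δ := fun s v => (s.getD v, some (s.getD v))

/-- The fetch-and-cons type with values in `W`.  The state is a list, initially empty;
`fac v` puts `v` at the head of the list and returns the whole list stored before. -/
def fetchAndCons (W : Type) [Primcodable W] : DataType where
  State := List W
  Inv := W
  Res := List W
  init := {[]}
  init_nonempty := Set.singleton_nonempty _
  δ := fun l v => (l, v :: l)

/-- The read/write register type with values in `A` and initial value `a₀`.  The invocation `none`
is a read, answered by `some a` where `a` is the current value; the invocation `some a` writes `a`
and is answered by the acknowledgement `none`. -/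
def register (A : Type) [Primcodable A] (a₀ : A) : DataType where
  State := A
  Inv := Option A
  Res := Option A
  init := {a₀}
  init_nonempty := Set.singleton_nonempty _
  δ := fun s x => match x with
    | none => (some s, s)
    | some a => (none, a)

/-- The type without any operation.  A system whose additional objects have this type has
registers only. -/
def noOperation : DataType where
  State := Unit
  Inv := Empty
  Res := Empty
  init := {()}
  init_nonempty := Set.singleton_nonempty _
  δ := fun _ x => x.elim

end DataType

/-! ## Histories of one object, and their consistency -/

/-- Events at one object of type `T` shared by `n` processes. -/
inductive ObjEvent (n : ℕ) (T : DataType) : Type where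
  | inv (p : Fin n) (x : T.Inv)
  | res (p : Fin n) (y : T.Res)

/-- The process that performs an event. -/
def ObjEvent.proc {n : ℕ} {T : DataType} : ObjEvent n T → Fin n
  | .inv p _ => p
  | .res p _ => p

/-- A finite or infinite history of one object: at each instant `i = 0, 1, 2, …` at most one event
occurs (`none` means that no event of this history occurs at that instant).
An operation of the history is identified with the instant of its invocation event. -/
abbrev History (n : ℕ) (T : DataType) : Type := ℕ → Option (ObjEvent n T)

/-- A sequence of completed operations, finite or infinite, in the order of their positions
(positions holding `none` are empty): `S k = some (i, y)` means that the operation invoked at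
instant `i` stands at position `k` and is answered by `y`. -/
abbrev SeqHistory (T : DataType) : Type := ℕ → Option (ℕ × T.Res)

namespace History

variable {n : ℕ} {T : DataType}

/-- The event at instant `j` is the response, with value `y`, of the operation invoked at `i`:
it is the next event after `i` of the process that performs this operation. -/
def Returns (H : History n T) (i j : ℕ) (y : T.Res) : Prop :=
  ∃ (p : Fin n) (x : T.Inv), H i = some (.inv p x) ∧ i < j ∧ H j = some (.res p y) ∧
    ∀ k, i < k → k < j → ∀ ev, H k = some ev → ev.proc ≠ p

/-- An event of `H` that occurs at instant `i` is still present after the removal of the first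
`t` events of `H`. -/
def InSuffix (H : History n T) (t i : ℕ) : Prop :=
  t ≤ Nat.count (fun k => (H k).isSome = true) i

/-- `S` is a legal sequential history of type `T` made of operations invoked in `H`, each of
them occurring at most once. -/
def IsLegal (H : History n T) (S : SeqHistory T) : Prop :=
  (∀ k k' i y y', S k = some (i, y) → S k' = some (i, y') → k = k') ∧
  ∃ st : ℕ → T.State, st 0 ∈ T.init ∧ ∀ k,
    match S k with
    | none => st (k + 1) = st k
    | some (i, y) => ∃ (p : Fin n) (x : T.Inv),
        H i = some (.inv p x) ∧ T.δ (st k) x = (y, st (k + 1))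

/-- Weak consistency: each operation that has a response in `H` has an explanation, a legal
sequential history which only contains operations invoked before that response, which contains all
previous operations of the same process, and which ends with this operation and the same response. -/
def WeaklyConsistent (H : History n T) : Prop :=
  ∀ i j y, H.Returns i j y → ∃ S : SeqHistory T, H.IsLegal S ∧
    (∀ k i' y', S k = some (i', y') → i' < j) ∧
    (∀ p x i' x', H i = some (.inv p x) → H i' = some (.inv p x') → i' < i →
      ∃ k y', S k = some (i', y')) ∧
    (∃ k, S k = some (i, y) ∧ ∀ k', k < k' → S k' = none)

/-- `S` is a `t`-linearization of `H`. -/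
structure IsLinearization (H : History n T) (t : ℕ) (S : SeqHistory T) : Prop where
  /-- `S` is legal and consists of operations invoked in `H`. -/
  legal : H.IsLegal S
  /-- Every operation completed in `H` is completed in `S`. -/
  complete : ∀ i j y, H.Returns i j y → ∃ k y', S k = some (i, y')
  /-- The order of non-overlapping operations is respected after the first `t` events. -/
  order : ∀ i j y i', H.Returns i j y → j < i' → H.InSuffix t j → H.InSuffix t i' →
    ∀ k' y', S k' = some (i', y') → ∃ k y'', S k = some (i, y'') ∧ k < k'
  /-- Responses given after the first `t` events are the same in `S`. -/
  response : ∀ i j y, H.Returns i j y → H.InSuffix t j → ∃ k, S k = some (i, y)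

/-- `t`-linearizability. -/
def TLinearizable (H : History n T) (t : ℕ) : Prop :=
  ∃ S, H.IsLinearization t S

/-- Linearizability. -/
def Linearizable (H : History n T) : Prop :=
  H.TLinearizable 0

/-- Eventual linearizability. -/
def EventuallyLinearizable (H : History n T) : Prop :=
  H.WeaklyConsistent ∧ ∃ t, H.TLinearizable t

end History

/-! ## Implementations and their executions -/

/-- A program for each of `n` processes, implementing an object of type `T` on top of countably
many shared objects `0, 1, 2, …` of type `O` and countably many shared registers `0, 1, 2, …` with
values in `Val`.  Every process has a local state, kept between operations.  Local computations
are arbitrary computable functions. -/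
structure Implementation (n : ℕ) (T O : DataType) where
  /-- Values of the registers. -/
  Val : Type
  /-- Local states. -/
  Loc : Type
  [valCode : Primcodable Val]
  [locCode : Primcodable Loc]
  /-- Initial values of the registers. -/
  regInit : ℕ → Val
  /-- Initial local states. -/
  locInit : Fin n → Loc
  /-- New local state when an operation of the implemented object is invoked. -/
  onInvoke : Fin n → Loc → T.Inv → Loc
  /-- What a process executing an operation does next: return a value, or invoke an operation of a
  shared object, or invoke an operation of a register. -/
  action : Fin n → Loc → T.Res ⊕ ((ℕ × O.Inv) ⊕ (ℕ × Option Val))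
  /-- New local state when a shared object answers. -/
  onObjReply : Fin n → Loc → O.Res → Loc
  /-- New local state when a register answers. -/
  onRegReply : Fin n → Loc → Option Val → Loc
  regInit_computable : Computable regInit
  onInvoke_computable : ∀ p, Computable₂ (onInvoke p)
  action_computable : ∀ p, Computable (action p)
  onObjReply_computable : ∀ p, Computable₂ (onObjReply p)
  onRegReply_computable : ∀ p, Computable₂ (onRegReply p)

attribute [instance] Implementation.valCode Implementation.locCode

/-- Events of a system: invocations and responses of the implemented object, of the shared
objects of type `O`, and of the registers. -/
inductive SysEvent (n : ℕ) (T O : DataType) (A : Type) : Type where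
  | invoke (p : Fin n) (x : T.Inv)
  | ret (p : Fin n) (y : T.Res)
  | callObj (p : Fin n) (k : ℕ) (x : O.Inv)
  | replyObj (p : Fin n) (k : ℕ) (y : O.Res)
  | callReg (p : Fin n) (k : ℕ) (x : Option A)
  | replyReg (p : Fin n) (k : ℕ) (y : Option A)

/-- The process that performs an event. -/
def SysEvent.proc {n : ℕ} {T O : DataType} {A : Type} : SysEvent n T O A → Fin n
  | .invoke p _ => p
  | .ret p _ => p
  | .callObj p _ _ => p
  | .replyObj p _ _ => p
  | .callReg p _ _ => p
  | .replyReg p _ _ => p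

/-- Control status of a process: between two operations, executing an operation, or waiting for
the answer of a shared object or of a register. -/
inductive Status : Type where
  | idle
  | running
  | waitObj (k : ℕ)
  | waitReg (k : ℕ)

namespace Implementation

variable {n : ℕ} {T O : DataType}

/-- A sequence of events of the system, at most one per instant. -/
abbrev Run (I : Implementation n T O) : Type := ℕ → Option (SysEvent n T O I.Val)

/-- The steps of process `p`. -/
inductive LocalStep (I : Implementation n T O) (p : Fin n) :
    Status × I.Loc → SysEvent n T O I.Val → Status × I.Loc → Prop where
  | invoke (s : I.Loc) (x : T.Inv) :
      LocalStep I p (.idle, s) (.invoke p x) (.running, I.onInvoke p s x)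
  | ret (s : I.Loc) (y : T.Res) (h : I.action p s = .inl y) :
      LocalStep I p (.running, s) (.ret p y) (.idle, s)
  | callObj (s : I.Loc) (k : ℕ) (x : O.Inv) (h : I.action p s = .inr (.inl (k, x))) :
      LocalStep I p (.running, s) (.callObj p k x) (.waitObj k, s)
  | replyObj (s : I.Loc) (k : ℕ) (y : O.Res) :
      LocalStep I p (.waitObj k, s) (.replyObj p k y) (.running, I.onObjReply p s y)
  | callReg (s : I.Loc) (k : ℕ) (x : Option I.Val) (h : I.action p s = .inr (.inr (k, x))) :
      LocalStep I p (.running, s) (.callReg p k x) (.waitReg k, s)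
  | replyReg (s : I.Loc) (k : ℕ) (y : Option I.Val) :
      LocalStep I p (.waitReg k, s) (.replyReg p k y) (.running, I.onRegReply p s y)

/-- A step of the system: one process takes a step, the others do not change. -/
def Step (I : Implementation n T O) (c : Fin n → Status × I.Loc) (ev : SysEvent n T O I.Val)
    (c' : Fin n → Status × I.Loc) : Prop :=
  ∃ p, I.LocalStep p (c p) ev (c' p) ∧ ∀ q, q ≠ p → c' q = c q

/-- The events are produced by the programs, started in their initial local states and interleaved
in an arbitrary way. -/
def Follows (I : Implementation n T O) (e : I.Run) : Prop :=
  ∃ c : ℕ → Fin n → Status × I.Loc,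
    (∀ p, c 0 p = (.idle, I.locInit p)) ∧
    ∀ i, match e i with
      | none => c (i + 1) = c i
      | some ev => I.Step (c i) ev (c (i + 1))

/-- The history of the implemented object in a run. -/
def history (I : Implementation n T O) (e : I.Run) : History n T := fun i =>
  match e i with
  | some (.invoke p x) => some (.inv p x)
  | some (.ret p y) => some (.res p y)
  | _ => none

/-- The history of the `k`-th shared object of type `O` in a run. -/
def objHistory (I : Implementation n T O) (e : I.Run) (k : ℕ) : History n O := fun i =>
  match e i with
  | some (.callObj p k' x) => if k' = k then some (.inv p x) else none
  | some (.replyObj p k' y) => if k' = k then some (.res p y) else none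
  | _ => none

/-- The history of the `k`-th register in a run. -/
def regHistory (I : Implementation n T O) (e : I.Run) (k : ℕ) :
    History n (DataType.register I.Val (I.regInit k)) := fun i =>
  match e i with
  | some (.callReg p k' x) => if k' = k then some (.inv p x) else none
  | some (.replyReg p k' y) => if k' = k then some (.res p y) else none
  | _ => none

/-- The executions of an implementation, finite or infinite: the shared objects of type `O` are
only known to be eventually linearizable, the registers are linearizable. -/
structure IsExecution (I : Implementation n T O) (e : I.Run) : Prop where
  follows : I.Follows e
  objects : ∀ k, (I.objHistory e k).EventuallyLinearizable
  registers : ∀ k, (I.regHistory e k).Linearizable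

/-- Wait-freedom: in every execution, every operation terminates, unless the process that performs
it stops taking steps; the other processes play no role in this. -/
def WaitFree (I : Implementation n T O) : Prop :=
  ∀ e, I.IsExecution e → ∀ i p x, e i = some (.invoke p x) →
    (∃ j y, i < j ∧ e j = some (.ret p y)) ∨
    ∃ m, ∀ j, m ≤ j → ∀ ev, e j = some ev → ev.proc ≠ p

/-- Every history produced by the implementation is eventually linearizable. -/
def EventuallyLinearizable (I : Implementation n T O) : Prop :=
  ∀ e, I.IsExecution e → (I.history e).EventuallyLinearizable

/-- The programs never access a register with index `m` or more. -/
def UsesRegistersBelow (I : Implementation n T O) (m : ℕ) : Prop :=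
  ∀ p s k x, I.action p s = .inr (.inr (k, x)) → k < m

end Implementation

/-- In a system of `n` processes, eventually linearizable objects of type `O` together with
linearizable registers can wait-free implement an eventually linearizable object of type `T`. -/
def EventuallyImplements (n : ℕ) (O T : DataType) : Prop :=
  ∃ I : Implementation n T O, I.WaitFree ∧ I.EventuallyLinearizable

/-- In a system of `n` processes, finitely many linearizable registers (and no other objects)
can wait-free implement an eventually linearizable object of type `T`. -/
def EventuallyImplementsFromRegisters (n : ℕ) (T : DataType) : Prop :=
  ∃ I : Implementation n T DataType.noOperation,
    I.WaitFree ∧ I.EventuallyLinearizable ∧ ∃ m, I.UsesRegistersBelow m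

/-- The eventual consensus number of `O`: the largest `n` such that eventually linearizable objects
of type `O` and linearizable registers can wait-free implement an `n`-process eventually linearizable
fetch-and-cons object with values in `W` (and `⊤` if there are arbitrarily large such `n`). -/
noncomputable def eventualConsensusNumber (W : Type) [Primcodable W] (O : DataType) : ℕ∞ :=
  sSup {m : ℕ∞ | ∃ n : ℕ, m = n ∧ EventuallyImplements n O (DataType.fetchAndCons W)}

/-! The number is at least 1 because a single process can keep the fetch-and-cons list in its local
state (`eventuallyImplements_one`).

For the upper bound, take a wait-free implementation for at least two processes and run only two of
them, always with the same argument `w`, against an adversary that chooses the schedule and the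
answers of the consensus objects. The adversary answers the first proposal of a process to an object
by that very proposal; a later one gets the first proposal of process `false` if there is one, and
the process's own first proposal otherwise. The recorded first proposals of an object change at most
twice, and afterwards all answers agree, so every schedule yields a genuine execution
(`isExecution_run`). Such objects are no stronger than registers: a first proposal is a write to a
single-writer location with an answer known in advance, and a later one is a mere read
(`turn_effect`).

The processes proceed in rounds of one operation each. Round `m` is good if the two answers have
lengths `2 * m` and `2 * m + 1`, and a process that runs entirely before the other gets the shorter
list. If all rounds possible from a quiet configuration were good, the shorter answer would elect a
winner, and the classical valency argument applies. Either process can win by running first, and no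
configuration is critical, because reads, commuting changes and overwriting writes all leave a
common possible winner (`not_critical`). So bivalence can be kept forever, and some process takes
infinitely many steps without completing its operation, against wait-freedom. Hence every quiet
configuration admits a bad round (`exists_bad_round`).

A single bad round is compatible with eventual linearizability. Bad rounds end in quiet
configurations, however, so infinitely many can be chained (`exists_bad_run`), whereas every
`t`-linearizable history made of rounds contains a good one (`TLinearizable.exists_good_round`).

For consensus from registers, each process owns a register for its first proposal. An operation
writes it and scans the registers in a fixed order up to the first value found, at the latest its
own. Each register only ever receives one value, so its reads are eventually constant, and from then
on all scans find the same value. Every value found is a first proposal, which gives weak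
consistency. -/

namespace History

/-! ### Elementary facts on histories -/

variable {n : ℕ}

theorem InSuffix.le {T : DataType} {H : History n T} {t i : ℕ} (h : H.InSuffix t i) : t ≤ i :=
  le_trans h (Nat.count_le _)

theorem Returns.lt {T : DataType} {H : History n T} {i j : ℕ} {y : T.Res}
    (h : H.Returns i j y) : i < j := by
  obtain ⟨p, x, -, h, -⟩ := h
  exact h

theorem Returns.unique {T : DataType} {H : History n T} {i j j' : ℕ} {y y' : T.Res}
    (h : H.Returns i j y) (h' : H.Returns i j' y') : j = j' ∧ y = y' := by
  obtain ⟨p, x, hi, hij, hj, hb⟩ := h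
  obtain ⟨p', x', hi', hij', hj', hb'⟩ := h'
  rw [hi] at hi'
  simp only [Option.some.injEq, ObjEvent.inv.injEq] at hi'
  obtain ⟨rfl, rfl⟩ := hi'
  rcases lt_trichotomy j j' with hlt | rfl | hlt
  · exact absurd rfl (hb' j hij hlt _ hj)
  · rw [hj] at hj'
    simp only [Option.some.injEq, ObjEvent.res.injEq, true_and] at hj'
    exact ⟨rfl, hj'⟩
  · exact absurd rfl (hb j' hij' hlt _ hj')

/-- Operations that return late were invoked late. -/
theorem exists_late_return {T : DataType} (H : History n T) (M : ℕ) :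
    ∃ M', ∀ i j y, H.Returns i j y → M' ≤ j → M ≤ i := by
  induction M with
  | zero => exact ⟨0, fun _ _ _ _ _ => Nat.zero_le _⟩
  | succ M ih =>
    obtain ⟨M', hM'⟩ := ih
    by_cases hr : ∃ j y, H.Returns M j y
    · obtain ⟨j₀, y₀, h₀⟩ := hr
      refine ⟨max M' (j₀ + 1), fun i j y h hj => ?_⟩
      have h1 := hM' i j y h (le_trans (le_max_left _ _) hj)
      rcases h1.lt_or_eq with h2 | rfl
      · exact h2
      · have := (h.unique h₀).1
        have := le_trans (le_max_right _ _) hj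
        omega
    · push Not at hr
      refine ⟨M', fun i j y h hj => ?_⟩
      have h1 := hM' i j y h hj
      rcases h1.lt_or_eq with h2 | rfl
      · exact h2
      · exact absurd h (hr j y)

/-! ### Criteria for consensus histories -/

section Consensus

variable {V : Type} [Primcodable V] {H : History n (DataType.consensus V)}

open Classical in
/-- The sequence of proposals that starts with the one invoked at `i₀`, continues with those
invoked at the instants in `Q`, and is answered by `y` throughout. -/
noncomputable def decidedSeq (i₀ : ℕ) (y : V) (Q : ℕ → Prop) :
    SeqHistory (DataType.consensus V)
  | 0 => some (i₀, y)
  | a + 1 => if Q a then some (a, y) else none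

theorem decidedSeq_succ {i₀ : ℕ} {y : V} {Q : ℕ → Prop} {a : ℕ} (h : Q a) :
    decidedSeq i₀ y Q (a + 1) = some (a, y) :=
  if_pos h

theorem decidedSeq_eq_some {i₀ : ℕ} {y : V} {Q : ℕ → Prop} {k i : ℕ} {y' : V}
    (h : decidedSeq i₀ y Q k = some (i, y')) : y' = y ∧ ((k = 0 ∧ i = i₀) ∨ (k = i + 1 ∧ Q i)) := by
  cases k with
  | zero =>
    have h := Prod.ext_iff.1 (Option.some.inj h)
    exact ⟨h.2.symm, .inl ⟨rfl, h.1.symm⟩⟩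
  | succ a =>
    by_cases ha : Q a
    · have h := Prod.ext_iff.1 (Option.some.inj ((decidedSeq_succ ha).symm.trans h))
      obtain rfl : a = i := h.1
      exact ⟨h.2.symm, .inr ⟨rfl, ha⟩⟩
    · rw [show decidedSeq i₀ y Q (a + 1) = none from if_neg ha] at h
      cases h

/-- The operation at position 0 proposes `y` itself, so the state is undecided only before it, and
every later proposal is answered by `y` whatever its argument. -/
theorem isLegal_decidedSeq {i₀ : ℕ} {p₀ : Fin n} {y : V} {Q : ℕ → Prop}
    (h₀ : H i₀ = some (.inv p₀ y)) (hne : ¬ Q i₀)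
    (hQ : ∀ a, Q a → ∃ p x, H a = some (.inv p x)) : H.IsLegal (decidedSeq i₀ y Q) := by
  refine ⟨fun k k' i y₁ y₂ h1 h2 => ?_, fun k => if k = 0 then none else some y, rfl, ?_⟩
  · rcases decidedSeq_eq_some h1 with ⟨-, ⟨rfl, rfl⟩ | ⟨rfl, q1⟩⟩ <;>
    rcases decidedSeq_eq_some h2 with ⟨-, ⟨rfl, h3⟩ | ⟨rfl, q2⟩⟩
    · rfl
    · exact absurd q2 hne
    · exact absurd (h3 ▸ q1) hne
    · rfl
  · intro k
    cases k with
    | zero => exact ⟨p₀, y, h₀, rfl⟩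
    | succ a =>
      by_cases ha : Q a
      · obtain ⟨p, x, hx⟩ := hQ a ha
        rw [decidedSeq_succ ha]
        exact ⟨p, x, hx, rfl⟩
      · rw [show decidedSeq i₀ y Q (a + 1) = none from if_neg ha]
        rfl

/-- A consensus history is weakly consistent if every returned value has been proposed, by another
operation or by the first operation of its process. -/
theorem weaklyConsistent_of_proposed
    (h : ∀ (i j : ℕ) (y : V) (p : Fin n) (x : V), H.Returns i j y → H i = some (.inv p x) →
      ∃ i₀ < j, ∃ p₀, H i₀ = some (.inv p₀ y) ∧
        (i₀ = i → ∀ i' < i, ∀ x' : V, H i' ≠ some (.inv p x'))) :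
    H.WeaklyConsistent := by
  intro i j y hr
  obtain ⟨p, x, hi, hij, -, -⟩ := id hr
  obtain ⟨i₀, h₀j, p₀, h₀, hfirst⟩ := h i j y p x hr hi
  refine ⟨decidedSeq i₀ y (fun a => a ≤ i ∧ a ≠ i₀ ∧ ∃ x : V, H a = some (.inv p x)),
    isLegal_decidedSeq h₀ (fun h => h.2.1 rfl) (fun a ha => ⟨p, ha.2.2⟩), ?_, ?_, ?_⟩
  · intro k i' y' hk
    rcases decidedSeq_eq_some hk with ⟨-, ⟨-, rfl⟩ | ⟨-, h1, -⟩⟩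
    · exact h₀j
    · exact lt_of_le_of_lt h1 hij
  · intro p' x₁ i' x' h1 h2 hlt
    rw [hi] at h1
    simp only [Option.some.injEq, ObjEvent.inv.injEq] at h1
    obtain ⟨rfl, rfl⟩ := h1
    by_cases hi' : i' = i₀
    · exact ⟨0, y, by rw [hi']; rfl⟩
    · exact ⟨i' + 1, y, decidedSeq_succ ⟨hlt.le, hi', x', h2⟩⟩
  -- An operation that supplies its own value sits at position 0, and it comes last only if its
  -- process has no earlier operation. This is where the last clause of the hypothesis is needed.
  · by_cases hi₀ : i₀ = i
    · refine ⟨0, by rw [← hi₀]; rfl, fun k' hk' => ?_⟩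
      by_contra hne
      obtain ⟨⟨i', y'⟩, hs⟩ := Option.ne_none_iff_exists'.1 hne
      rcases decidedSeq_eq_some hs with ⟨-, ⟨rfl, -⟩ | ⟨-, h1, h2, x', h3⟩⟩
      · exact absurd hk' (lt_irrefl _)
      · exact hfirst hi₀ i' (lt_of_le_of_ne h1 (hi₀ ▸ h2)) x' h3
    · refine ⟨i + 1, decidedSeq_succ ⟨le_rfl, Ne.symm hi₀, x, hi⟩, fun k' hk' => ?_⟩
      by_contra hne
      obtain ⟨⟨i', y'⟩, hs⟩ := Option.ne_none_iff_exists'.1 hne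
      rcases decidedSeq_eq_some hs with ⟨-, ⟨rfl, -⟩ | ⟨rfl, h1, -⟩⟩ <;> omega

/-- A consensus history is `t`-linearizable for some `t` if eventually only one proposed value is
returned. -/
theorem tLinearizable_of_decided {M i₀ : ℕ} {p₀ : Fin n} {y : V}
    (h₀ : H i₀ = some (.inv p₀ y))
    (h : ∀ (i j : ℕ) (y' : V), H.Returns i j y' → M ≤ j → y' = y) :
    H.TLinearizable (max M (i₀ + 1)) := by
  let Q : ℕ → Prop := fun a => a ≠ i₀ ∧ ∃ (p : Fin n) (x : V), H a = some (.inv p x)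
  have hmem : ∀ i (p : Fin n) (x : V), H i = some (.inv p x) →
      ∃ k, decidedSeq i₀ y Q k = some (i, y) ∧ k ≤ i + 1 := by
    intro i p x hi
    by_cases hi₀ : i = i₀
    · exact ⟨0, by rw [hi₀]; rfl, Nat.zero_le _⟩
    · exact ⟨i + 1, decidedSeq_succ ⟨hi₀, p, x, hi⟩, le_rfl⟩
  -- Moving `i₀` to the front could violate the order condition only if `i₀` lay beyond the first
  -- `t` events; `t ≥ i₀ + 1` excludes this. All other operations stand in the order of their
  -- invocations.
  refine ⟨decidedSeq i₀ y Q, isLegal_decidedSeq h₀ (fun h => h.1 rfl) (fun a ha => ha.2), ?_, ?_, ?_⟩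
  · rintro i j y' ⟨p, x, hi, -⟩
    obtain ⟨k, hk, -⟩ := hmem i p x hi
    exact ⟨k, y, hk⟩
  · rintro i j y' i' ⟨p, x, hi, hij, -⟩ hji' - hs k' y'' hk'
    obtain ⟨k, hk, hki⟩ := hmem i p x hi
    have := hs.le
    rcases decidedSeq_eq_some hk' with ⟨-, ⟨rfl, rfl⟩ | ⟨rfl, -⟩⟩
    · have := le_trans (le_max_right _ _) this
      omega
    · exact ⟨k, y, hk, by omega⟩
  · rintro i j y' hr hs
    obtain ⟨p, x, hi, -⟩ := id hr
    obtain ⟨k, hk, -⟩ := hmem i p x hi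
    have : y' = y := h i j y' hr (le_trans (le_max_left _ _) hs.le)
    exact ⟨k, this ▸ hk⟩

/-- If some response comes after `M`, its value was proposed and serves as the decision. If none
does, any proposal serves, since the requirement on late responses is void; without proposals the
empty sequence works. -/
theorem eventuallyLinearizable_of_decided
    (h : ∀ (i j : ℕ) (y : V) (p : Fin n) (x : V), H.Returns i j y → H i = some (.inv p x) →
      ∃ i₀ < j, ∃ p₀, H i₀ = some (.inv p₀ y) ∧
        (i₀ = i → ∀ i' < i, ∀ x' : V, H i' ≠ some (.inv p x')))
    (h' : ∃ M, ∀ (i j i' j' : ℕ) (y y' : V), H.Returns i j y → H.Returns i' j' y' →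
      M ≤ j → M ≤ j' → y = y') : H.EventuallyLinearizable := by
  refine ⟨weaklyConsistent_of_proposed h, ?_⟩
  obtain ⟨M, hM⟩ := h'
  by_cases hr : ∃ (i j : ℕ) (y : V), H.Returns i j y ∧ M ≤ j
  · obtain ⟨i, j, y, hr, hj⟩ := hr
    obtain ⟨p, x, hi, -⟩ := id hr
    obtain ⟨i₀, -, p₀, h₀, -⟩ := h i j y p x hr hi
    exact ⟨_, tLinearizable_of_decided h₀ (fun i' j' y' hr' hj' => hM _ _ _ _ _ _ hr' hr hj' hj)⟩
  · push Not at hr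
    by_cases hi : ∃ (i₀ : ℕ) (p₀ : Fin n) (y : V), H i₀ = some (.inv p₀ y)
    · obtain ⟨i₀, p₀, y, h₀⟩ := hi
      exact ⟨_, tLinearizable_of_decided (M := M) h₀
        (fun i j y' h1 h2 => absurd h2 (not_le.2 (hr i j y' h1)))⟩
    · push Not at hi
      refine ⟨0, fun _ => none, ⟨fun _ _ _ _ _ h => (by cases h), fun _ => none, rfl, fun _ => rfl⟩,
        ?_, ?_, ?_⟩
      · rintro i j y ⟨p, x, h1, -⟩
        exact absurd h1 (hi i p x)
      · rintro i j y i' ⟨p, x, h1, -⟩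
        exact absurd h1 (hi i p x)
      · rintro i j y ⟨p, x, h1, -⟩
        exact absurd h1 (hi i p x)

end Consensus

/-! ### Histories with atomic accesses -/

section Atomic

variable {T : DataType} {H : History n T} {A : ℕ → Option (Fin n × T.Inv × T.Res)}

theorem Returns.of_atomic (h₀ : ∀ a, H (2 * a) = (A a).map fun o => .inv o.1 o.2.1)
    (h₁ : ∀ a, H (2 * a + 1) = (A a).map fun o => .res o.1 o.2.2) {i j : ℕ} {y : T.Res}
    (h : H.Returns i j y) : ∃ a p x, i = 2 * a ∧ j = 2 * a + 1 ∧ A a = some (p, x, y) := by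
  obtain ⟨p, x, hi, hij, hj, hb⟩ := h
  obtain ⟨a, rfl | rfl⟩ := Nat.even_or_odd' i
  · rw [h₀] at hi
    simp only [Option.map_eq_some_iff, ObjEvent.inv.injEq, Prod.exists] at hi
    obtain ⟨p, x, y', ha, rfl, rfl⟩ := hi
    have h1 := h₁ a
    rw [ha] at h1
    have : j = 2 * a + 1 := by
      by_contra hne
      exact hb (2 * a + 1) (by omega) (by omega) _ h1 rfl
    subst this
    rw [hj] at h1
    simp only [Option.map_some, Option.some.injEq, ObjEvent.res.injEq, true_and] at h1
    exact ⟨a, p, x, rfl, rfl, h1 ▸ ha⟩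
  · rw [h₁] at hi
    simp at hi

/-- A history in which every operation is answered at once, according to the transition map, is
linearizable. -/
theorem linearizable_of_atomic (h₀ : ∀ a, H (2 * a) = (A a).map fun o => .inv o.1 o.2.1)
    (h₁ : ∀ a, H (2 * a + 1) = (A a).map fun o => .res o.1 o.2.2)
    (st : ℕ → T.State) (hinit : st 0 ∈ T.init)
    (hnone : ∀ a, A a = none → st (a + 1) = st a)
    (hsome : ∀ a p x y, A a = some (p, x, y) → T.δ (st a) x = (y, st (a + 1))) :
    H.Linearizable := by
  -- The access at instants `2 * a` and `2 * a + 1` gets position `a`, so that positions follow real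
  -- time.
  refine ⟨fun a => (A a).map fun o => (2 * a, o.2.2), ⟨?_, st, hinit, fun a => ?_⟩, ?_, ?_, ?_⟩
  · intro k k' i y y' h h'
    simp only [Option.map_eq_some_iff, Prod.mk.injEq] at h h'
    obtain ⟨_, _, h, -⟩ := h
    obtain ⟨_, _, h', -⟩ := h'
    omega
  · rcases ha : A a with _ | ⟨p, x, y⟩
    · simpa [ha] using hnone a ha
    · simp only [ha, Option.map_some]
      exact ⟨p, x, by rw [h₀, ha]; rfl, hsome a p x y ha⟩
  · intro i j y h
    obtain ⟨a, p, x, rfl, rfl, ha⟩ := h.of_atomic h₀ h₁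
    exact ⟨a, y, by simp [ha]⟩
  · intro i j y i' h hj _ _ k' y' hk'
    obtain ⟨a, p, x, rfl, rfl, ha⟩ := h.of_atomic h₀ h₁
    simp only [Option.map_eq_some_iff, Prod.mk.injEq] at hk'
    obtain ⟨_, _, rfl, -⟩ := hk'
    exact ⟨a, y, by simp [ha], by omega⟩
  · intro i j y h _
    obtain ⟨a, p, x, rfl, rfl, ha⟩ := h.of_atomic h₀ h₁
    exact ⟨a, by simp [ha]⟩

end Atomic

end History

/-! ## One process -/

/-- The implementation of a fetch-and-cons object for a single process, which keeps the list in its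
local state. -/
def localFetchAndCons (W O : Type) [Primcodable W] [Primcodable O] :
    Implementation 1 (DataType.fetchAndCons W) (DataType.consensus O) where
  Val := Unit
  Loc := List W
  regInit := fun _ => ()
  locInit := fun _ => []
  onInvoke := fun _ l w => w :: l
  action := fun _ l => .inl l.tail
  onObjReply := fun _ l _ => l
  onRegReply := fun _ l _ => l
  regInit_computable := Computable.const _
  onInvoke_computable := fun _ => (Primrec.list_cons.comp Primrec.snd Primrec.fst).to_comp
  action_computable := fun _ => (Primrec.sumInl.comp Primrec.list_tail).to_comp
  onObjReply_computable := fun _ => Computable.fst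
  onRegReply_computable := fun _ => Computable.fst

namespace localFetchAndCons

variable {W O : Type} [Primcodable W] [Primcodable O]

/-- The steps of the process, as transitions between pairs of a status and a list. -/
inductive StepCase : Status × List W → Option (SysEvent 1 (DataType.fetchAndCons W)
    (DataType.consensus O) Unit) → Status × List W → Prop
  | none (s : Status × List W) : StepCase s none s
  | invoke (l : List W) (w : W) : StepCase (.idle, l) (some (.invoke 0 w)) (.running, w :: l)
  | ret (l : List W) : StepCase (.running, l) (some (.ret 0 l.tail)) (.idle, l)

theorem stepCase {e : (localFetchAndCons W O).Run} (h : (localFetchAndCons W O).Follows e) :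
    ∃ c : ℕ → Status × List W, c 0 = (.idle, []) ∧
      ∀ i, ((c i).1 = .idle ∨ (c i).1 = .running) ∧ StepCase (c i) (e i) (c (i + 1)) := by
  obtain ⟨c, h0, hc⟩ := h
  have key : ∀ i, ((c i 0).1 = .idle ∨ (c i 0).1 = .running) →
      StepCase (c i 0) (e i) (c (i + 1) 0) := by
    intro i hi
    have := hc i
    rcases he : e i with _ | ev
    · rw [he] at this
      rw [show c (i + 1) = c i from this]
      exact .none _
    · rw [he] at this
      obtain ⟨p, hp, -⟩ := this
      obtain rfl : p = 0 := Subsingleton.elim _ _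
      generalize c i 0 = s at *
      generalize c (i + 1) 0 = s' at *
      cases hp with
      | invoke s x => exact .invoke _ _
      | ret s y h =>
        obtain rfl : List.tail s = y := Sum.inl.inj h
        exact .ret _
      | callObj s k x h => cases h
      | replyObj s k y => simp at hi
      | callReg s k x h => cases h
      | replyReg s k y => simp at hi
  have hst : ∀ i, (c i 0).1 = .idle ∨ (c i 0).1 = .running := by
    intro i
    induction i with
    | zero => left; rw [h0]
    | succ i ih =>
      have h1 := key i ih
      generalize c i 0 = s at *
      generalize c (i + 1) 0 = s' at *
      generalize e i = ev at *
      cases h1 <;> simp_all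
  exact ⟨fun i => c i 0, h0 0, fun i => ⟨hst i, key i (hst i)⟩⟩

section Run

variable {e : (localFetchAndCons W O).Run} {c : ℕ → Status × List W}

theorem history_cases (hc : ∀ i, StepCase (c i) (e i) (c (i + 1))) (i : ℕ) :
    ((localFetchAndCons W O).history e i = none ∧ e i = none ∧ c (i + 1) = c i) ∨
    (∃ (w : W), (localFetchAndCons W O).history e i = some (.inv 0 w) ∧
      e i = some (.invoke 0 w) ∧ (c i).1 = .idle ∧ c (i + 1) = (.running, w :: (c i).2)) ∨
    ((localFetchAndCons W O).history e i = some (.res 0 (c i).2.tail) ∧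
      e i = some (.ret 0 (c i).2.tail) ∧ (c i).1 = .running ∧ c (i + 1) = (.idle, (c i).2)) := by
  have h := hc i
  unfold Implementation.history
  generalize c i = s at *
  generalize c (i + 1) = s' at *
  generalize e i = ev at *
  cases h with
  | none => exact .inl ⟨rfl, rfl, rfl⟩
  | invoke l w => exact .inr (.inl ⟨w, rfl, rfl, rfl, rfl⟩)
  | ret l => exact .inr (.inr ⟨rfl, rfl, rfl, rfl⟩)

/-- The new element is put on the local list at the invocation already, and nothing changes that
list before the response, which returns its tail. -/
theorem response_eq (hc : ∀ i, StepCase (c i) (e i) (c (i + 1))) {i j : ℕ} {y : List W}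
    (h : ((localFetchAndCons W O).history e).Returns i j y) : y = (c i).2 := by
  obtain ⟨p, x, hi, hij, hj, hb⟩ := h
  have h1 : ∃ w, c (i + 1) = (.running, w :: (c i).2) := by
    rcases history_cases hc i with ⟨h, -⟩ | ⟨w, -, -, -, h⟩ | ⟨h, -⟩
    · rw [h] at hi; cases hi
    · exact ⟨w, h⟩
    · rw [h] at hi; cases hi
  obtain ⟨w, hw⟩ := h1
  have h2 : ∀ k, i + 1 ≤ k → k ≤ j → c k = c (i + 1) := by
    intro k hk
    induction k, hk using Nat.le_induction with
    | base => intro _; rfl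
    | succ k hk ih =>
      intro hkj
      rw [← ih (by omega)]
      rcases history_cases hc k with ⟨-, -, h⟩ | ⟨w, h, -⟩ | ⟨h, -⟩
      · exact h
      · exact absurd (Subsingleton.elim _ _) (hb k (by omega) (by omega) _ h)
      · exact absurd (Subsingleton.elim _ _) (hb k (by omega) (by omega) _ h)
  have h3 := h2 j hij le_rfl
  rcases history_cases hc j with ⟨h, -⟩ | ⟨w, h, -⟩ | ⟨h, -⟩
  · rw [h] at hj; cases hj
  · rw [h] at hj; cases hj
  · rw [h, h3, hw] at hj
    obtain h := ObjEvent.res.inj (Option.some.inj hj)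
    exact h.2.symm

/-- The operations invoked before instant `m`, in the order of their invocations. -/
def invocationSeq (e : (localFetchAndCons W O).Run) (c : ℕ → Status × List W) (m : ℕ) :
    SeqHistory (DataType.fetchAndCons W) := fun k =>
  if k < m then
    match (localFetchAndCons W O).history e k with
    | some (.inv _ _) => some (k, (c k).2)
    | _ => none
  else none

theorem invocationSeq_of_inv {m i : ℕ} {p : Fin 1} {x : W}
    (hi : (localFetchAndCons W O).history e i = some (.inv p x)) (hm : i < m) :
    invocationSeq e c m i = some (i, (c i).2) := by
  simp only [invocationSeq, hm, hi, if_true]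
  rfl

theorem invocationSeq_eq_some {m k i : ℕ} {y : List W}
    (h : invocationSeq e c m k = some (i, y)) :
    k = i ∧ i < m ∧ y = (c i).2 ∧
      ∃ x : W, (localFetchAndCons W O).history e i = some (.inv 0 x) := by
  unfold invocationSeq at h
  split at h
  · split at h
    · rename_i p x hx
      have h := Prod.ext_iff.1 (Option.some.inj h)
      obtain rfl : k = i := h.1
      exact ⟨rfl, by assumption, h.2.symm, x, by rw [hx, Subsingleton.elim p 0]⟩
    · cases h
  · cases h

/-- The local list serves as the abstract state, since it grows exactly at invocations; the `min`
freezes it after the cut at `m`. -/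
theorem isLegal_invocationSeq (h0 : c 0 = (.idle, []))
    (hc : ∀ i, StepCase (c i) (e i) (c (i + 1))) (m : ℕ) :
    ((localFetchAndCons W O).history e).IsLegal (invocationSeq e c m) := by
  refine ⟨fun k k' i y y' h h' => ?_, fun k => (c (min k m)).2, ?_, fun k => ?_⟩
  · rw [(invocationSeq_eq_some h).1, (invocationSeq_eq_some h').1]
  · simp only [Nat.zero_min, h0]
    exact rfl
  · by_cases hk : k < m
    · have hk1 : min (k + 1) m = k + 1 := by omega
      have hk0 : min k m = k := by omega
      simp only [hk0, hk1]
      rcases history_cases hc k with ⟨h, -, h'⟩ | ⟨w, h, -, -, h'⟩ | ⟨h, -, -, h'⟩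
      · have : invocationSeq e c m k = none := by simp [invocationSeq, h]
        rw [this, h']
      · rw [invocationSeq_of_inv h hk, h']
        exact ⟨0, w, h, rfl⟩
      · have : invocationSeq e c m k = none := by simp [invocationSeq, h]
        rw [this, h']
    · have : invocationSeq e c m k = none := by simp [invocationSeq, hk]
      rw [this]
      have hk1 : min (k + 1) m = m := by omega
      have hk0 : min k m = m := by omega
      simp only [hk0, hk1]
      rfl

end Run

theorem waitFree : (localFetchAndCons W O).WaitFree := by
  intro e he i p x hi
  obtain ⟨c, h0, hc⟩ := stepCase he.follows
  replace hc := fun i => (hc i).2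
  by_contra hcon
  push Not at hcon
  obtain ⟨hret, hinf⟩ := hcon
  have h : ∀ j, i + 1 ≤ j → (c j).1 = .running := by
    intro j hj
    induction j, hj using Nat.le_induction with
    | base =>
      rcases history_cases hc i with ⟨-, h, -⟩ | ⟨w, -, -, -, h⟩ | ⟨-, h, -⟩
      · rw [h] at hi; cases hi
      · rw [h]
      · rw [h] at hi; cases hi
    | succ j hj ih =>
      rcases history_cases hc j with ⟨-, -, h⟩ | ⟨w, -, -, h, -⟩ | ⟨-, h, -⟩
      · rw [h, ih]
      · rw [h] at ih; cases ih
      · rw [Subsingleton.elim p 0] at hret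
        exact absurd h (hret j _ (by omega))
  obtain ⟨j, hj, ev, hev, -⟩ := hinf (i + 1)
  rcases history_cases hc j with ⟨-, h', -⟩ | ⟨w, -, -, h', -⟩ | ⟨-, h', -⟩
  · rw [h'] at hev; cases hev
  · have := h j hj
    rw [h'] at this; cases this
  · rw [Subsingleton.elim p 0] at hret
    exact absurd h' (hret j _ (by omega))

theorem eventuallyLinearizable : (localFetchAndCons W O).EventuallyLinearizable := by
  intro e he
  obtain ⟨c, h0, hc⟩ := stepCase he.follows
  replace hc := fun i => (hc i).2
  refine ⟨?_, 0, ?_⟩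
  · intro i j y hr
    obtain ⟨p, x, hi, hij, -⟩ := id hr
    refine ⟨invocationSeq e c (i + 1), isLegal_invocationSeq h0 hc _, ?_, ?_, ?_⟩
    · intro k i' y' hk
      have := (invocationSeq_eq_some hk).2.1
      omega
    · intro p' x₁ i' x' _ h' hlt
      exact ⟨i', _, invocationSeq_of_inv h' (by omega)⟩
    · refine ⟨i, ?_, fun k' hk' => ?_⟩
      · rw [response_eq hc hr]
        exact invocationSeq_of_inv hi (by omega)
      · have : ¬ k' < i + 1 := by omega
        simp [invocationSeq, this]
  -- The cut moves along with the position, so no invocation is dropped: the full history is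
  -- linearized in invocation order with `t = 0`.
  · let S : SeqHistory (DataType.fetchAndCons W) := fun k => invocationSeq e c (k + 1) k
    have hinv : ∀ i (p : Fin 1) (x : W), (localFetchAndCons W O).history e i = some (.inv p x) →
        S i = some (i, (c i).2) := fun i p x h => invocationSeq_of_inv h (Nat.lt_succ_self _)
    refine ⟨S, ⟨fun k k' i y y' h h' => ?_, fun k => (c k).2, ?_, fun k => ?_⟩, ?_, ?_, ?_⟩
    · rw [(invocationSeq_eq_some h).1, (invocationSeq_eq_some h').1]
    · simp only [h0]
      exact rfl
    · rcases history_cases hc k with ⟨h, -, h'⟩ | ⟨w, h, -, -, h'⟩ | ⟨h, -, -, h'⟩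
      · have : S k = none := by simp [S, invocationSeq, h]
        rw [this]
        exact congrArg Prod.snd h'
      · rw [hinv _ _ _ h]
        exact ⟨0, w, h, (congrArg (fun s : Status × List W => ((c k).2, s.2)) h').symm⟩
      · have : S k = none := by simp [S, invocationSeq, h]
        rw [this]
        show (c (k + 1)).2 = (c k).2
        rw [h']
    · rintro i j y ⟨p, x, hi, -⟩
      exact ⟨i, _, hinv _ _ _ hi⟩
    · rintro i j y i' ⟨p, x, hi, hij, -⟩ hj - - k' y' hk'
      obtain ⟨rfl, -⟩ := invocationSeq_eq_some hk'
      exact ⟨i, _, hinv _ _ _ hi, by omega⟩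
    · intro i j y hr _
      obtain ⟨p, x, hi, -⟩ := id hr
      exact ⟨i, by rw [response_eq hc hr]; exact hinv _ _ _ hi⟩

end localFetchAndCons

theorem eventuallyImplements_one (W O : Type) [Primcodable W] [Primcodable O] :
    EventuallyImplements 1 (DataType.consensus O) (DataType.fetchAndCons W) :=
  ⟨localFetchAndCons W O, localFetchAndCons.waitFree, localFetchAndCons.eventuallyLinearizable⟩

/-! ## Executions with two active processes and atomic accesses -/

namespace TwoProcess

/-- The state of an active process.  `prog` counts the invocations and responses so far, so that it
is odd during an operation; `last` is the length of the list returned last. -/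
structure ProcState (Loc : Type) where
  loc : Loc
  prog : ℕ
  last : ℕ

/-- The shared memory: the contents of the registers, and the first proposal of each active process
to each consensus object. -/
structure Memory (Val V : Type) where
  reg : ℕ → Val
  own : Bool → ℕ → Option V

namespace Memory

variable {Val V : Type}

/-- The answer of consensus object `k` to process `p`: the first proposal of a process is answered
by its own value, later ones prefer the first proposal of process `false`. -/
def answer (m : Memory Val V) (p : Bool) (k : ℕ) (v : V) : V :=
  match m.own p k with
  | none => v
  | some u => (m.own false k).getD u

/-- An entry that is already present is kept. Thus `own p k` changes at most once, and only process
`p` changes it. -/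
def propose (m : Memory Val V) (p : Bool) (k : ℕ) (v : V) : Memory Val V where
  reg := m.reg
  own := fun q j => if q = p ∧ j = k then some ((m.own q j).getD v) else m.own q j

def write (m : Memory Val V) (k : ℕ) (a : Val) : Memory Val V where
  reg := Function.update m.reg k a
  own := m.own

end Memory

structure Config (Loc Val V : Type) where
  ps : Bool → ProcState Loc
  mem : Memory Val V

variable {n : ℕ} {V W : Type} [Primcodable V] [Primcodable W]

/-- The effect of a turn of a process: its new state, the new memory, at most two events, and the
state between them. -/
structure Turn (I : Implementation n (DataType.fetchAndCons W) (DataType.consensus V)) where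
  ps : ProcState I.Loc
  mem : Memory I.Val V
  first : Option (SysEvent n (DataType.fetchAndCons W) (DataType.consensus V) I.Val)
  mid : Status × I.Loc
  second : Option (SysEvent n (DataType.fetchAndCons W) (DataType.consensus V) I.Val)

variable (I : Implementation n (DataType.fetchAndCons W) (DataType.consensus V))
  (P : Bool → Fin n) (w : W)

/-- The turn of process `p` in state `s`. -/
def turn (p : Bool) (s : ProcState I.Loc) (m : Memory I.Val V) : Turn I :=
  if s.prog % 2 = 0 then
    ⟨⟨I.onInvoke (P p) s.loc w, s.prog + 1, s.last⟩, m, some (.invoke (P p) w),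
      (.running, I.onInvoke (P p) s.loc w), none⟩
  else match I.action (P p) s.loc with
    | .inl y => ⟨⟨s.loc, s.prog + 1, List.length (α := W) y⟩, m, some (.ret (P p) y),
        (.idle, s.loc), none⟩
    | .inr (.inl (k, v)) => ⟨⟨I.onObjReply (P p) s.loc (m.answer p k v), s.prog, s.last⟩,
        m.propose p k v, some (.callObj (P p) k v), (.waitObj k, s.loc),
        some (.replyObj (P p) k (m.answer p k v))⟩
    | .inr (.inr (k, none)) => ⟨⟨I.onRegReply (P p) s.loc (some (m.reg k)), s.prog, s.last⟩,
        m, some (.callReg (P p) k none), (.waitReg k, s.loc),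
        some (.replyReg (P p) k (some (m.reg k)))⟩
    | .inr (.inr (k, some a)) => ⟨⟨I.onRegReply (P p) s.loc none, s.prog, s.last⟩,
        m.write k a, some (.callReg (P p) k (some a)), (.waitReg k, s.loc),
        some (.replyReg (P p) k none)⟩

/-- The possible kinds of turns. -/
inductive TurnCase (p : Bool) (s : ProcState I.Loc) (m : Memory I.Val V) : Turn I → Prop
  | invoke (h : s.prog % 2 = 0) : TurnCase p s m
      ⟨⟨I.onInvoke (P p) s.loc w, s.prog + 1, s.last⟩, m, some (.invoke (P p) w),
        (.running, I.onInvoke (P p) s.loc w), none⟩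
  | ret (h : s.prog % 2 = 1) (y : List W) (ha : I.action (P p) s.loc = .inl y) : TurnCase p s m
      ⟨⟨s.loc, s.prog + 1, y.length⟩, m, some (.ret (P p) y), (.idle, s.loc), none⟩
  | obj (h : s.prog % 2 = 1) (k : ℕ) (v : V) (ha : I.action (P p) s.loc = .inr (.inl (k, v))) :
      TurnCase p s m ⟨⟨I.onObjReply (P p) s.loc (m.answer p k v), s.prog, s.last⟩,
        m.propose p k v, some (.callObj (P p) k v), (.waitObj k, s.loc),
        some (.replyObj (P p) k (m.answer p k v))⟩
  | read (h : s.prog % 2 = 1) (k : ℕ) (ha : I.action (P p) s.loc = .inr (.inr (k, none))) :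
      TurnCase p s m ⟨⟨I.onRegReply (P p) s.loc (some (m.reg k)), s.prog, s.last⟩,
        m, some (.callReg (P p) k none), (.waitReg k, s.loc),
        some (.replyReg (P p) k (some (m.reg k)))⟩
  | write (h : s.prog % 2 = 1) (k : ℕ) (a : I.Val)
      (ha : I.action (P p) s.loc = .inr (.inr (k, some a))) :
      TurnCase p s m ⟨⟨I.onRegReply (P p) s.loc none, s.prog, s.last⟩,
        m.write k a, some (.callReg (P p) k (some a)), (.waitReg k, s.loc),
        some (.replyReg (P p) k none)⟩

theorem turnCase (p : Bool) (s : ProcState I.Loc) (m : Memory I.Val V) :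
    TurnCase I P w p s m (turn I P w p s m) := by
  unfold turn
  split
  · exact .invoke ‹_›
  · have : s.prog % 2 = 1 := by omega
    split
    · exact .ret this _ ‹_›
    · exact .obj this _ _ ‹_›
    · exact .read this _ ‹_›
    · exact .write this _ _ ‹_›

variable {I}

/-- An idle process waits for the other one if it is ahead of it. -/
abbrev Config.Skips (p : Bool) (c : Config I.Loc I.Val V) : Prop :=
  (c.ps p).prog % 2 = 0 ∧ (c.ps (!p)).prog < (c.ps p).prog

/-- Skipped turns keep the processes in lockstep: nobody starts its next operation before the other
has completed as many operations. This produces the rounds. -/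
def step (p : Bool) (c : Config I.Loc I.Val V) : Config I.Loc I.Val V :=
  if c.Skips p then c else
    ⟨Function.update c.ps p (turn I P w p (c.ps p) c.mem).ps, (turn I P w p (c.ps p) c.mem).mem⟩

variable (I) in
def initial : Config I.Loc I.Val V where
  ps := fun p => ⟨I.locInit (P p), 0, 0⟩
  mem := ⟨I.regInit, fun _ _ => none⟩

variable (I) in
/-- The configuration after `i` turns of the schedule `σ`. -/
def config (σ : ℕ → Bool) : ℕ → Config I.Loc I.Val V
  | 0 => initial I P
  | i + 1 => step P w (σ i) (config σ i)

/-- The events of a turn of process `p`. -/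
def firstEvent (p : Bool) (c : Config I.Loc I.Val V) :
    Option (SysEvent n (DataType.fetchAndCons W) (DataType.consensus V) I.Val) :=
  if c.Skips p then none else (turn I P w p (c.ps p) c.mem).first

def secondEvent (p : Bool) (c : Config I.Loc I.Val V) :
    Option (SysEvent n (DataType.fetchAndCons W) (DataType.consensus V) I.Val) :=
  if c.Skips p then none else (turn I P w p (c.ps p) c.mem).second

variable (I) in
/-- The run of a schedule: the `i`-th turn takes place at the instants `2 * i` and `2 * i + 1`. -/
def run (σ : ℕ → Bool) : I.Run := fun j =>
  if j % 2 = 0 then firstEvent P w (σ (j / 2)) (config I P w σ (j / 2))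
  else secondEvent P w (σ (j / 2)) (config I P w σ (j / 2))

variable {P w}

@[simp] theorem run_even (σ : ℕ → Bool) (i : ℕ) :
    run I P w σ (2 * i) = firstEvent P w (σ i) (config I P w σ i) := by
  simp [run]

@[simp] theorem run_odd (σ : ℕ → Bool) (i : ℕ) :
    run I P w σ (2 * i + 1) = secondEvent P w (σ i) (config I P w σ i) := by
  have : (2 * i + 1) / 2 = i := by omega
  simp [run, this]

theorem step_of_skips {p : Bool} {c : Config I.Loc I.Val V} (h : c.Skips p) :
    step P w p c = c := if_pos h

theorem step_cases (p : Bool) (c : Config I.Loc I.Val V) :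
    (c.Skips p ∧ step P w p c = c ∧ firstEvent P w p c = none ∧ secondEvent P w p c = none) ∨
    (¬ c.Skips p ∧ ∃ A, TurnCase I P w p (c.ps p) c.mem A ∧
      step P w p c = ⟨Function.update c.ps p A.ps, A.mem⟩ ∧
      firstEvent P w p c = A.first ∧ secondEvent P w p c = A.second) := by
  by_cases h : c.Skips p
  · exact .inl ⟨h, if_pos h, if_pos h, if_pos h⟩
  · exact .inr ⟨h, _, turnCase I P w p _ _, if_neg h, if_neg h, if_neg h⟩

/-! ### The runs follow the programs -/

def ProcState.control {Loc : Type} (s : ProcState Loc) : Status × Loc :=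
  (if s.prog % 2 = 0 then .idle else .running, s.loc)

variable (P) in
/-- The states of all processes; the inactive ones stay in their initial states. -/
def Config.control (c : Config I.Loc I.Val V) (q : Fin n) : Status × I.Loc :=
  if q = P false then (c.ps false).control
  else if q = P true then (c.ps true).control
  else (.idle, I.locInit q)

theorem Config.control_apply (hP : P false ≠ P true) (c : Config I.Loc I.Val V) (p : Bool) :
    c.control P (P p) = (c.ps p).control := by
  cases p
  · simp [Config.control]
  · simp [Config.control, hP.symm]

theorem Config.control_update (hP : P false ≠ P true) (c : Config I.Loc I.Val V) (p : Bool)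
    (s : ProcState I.Loc) (m : Memory I.Val V) :
    Config.control P ⟨Function.update c.ps p s, m⟩ =
      Function.update (c.control P) (P p) s.control := by
  funext q
  cases p <;> by_cases h1 : q = P false <;> by_cases h2 : q = P true <;>
    simp_all [Config.control]

theorem TurnCase.localStep {p : Bool} {s : ProcState I.Loc} {m : Memory I.Val V} {A : Turn I}
    (h : TurnCase I P w p s m A) :
    (∃ ev, A.first = some ev ∧ I.LocalStep (P p) s.control ev A.mid) ∧
      (match A.second with
        | none => A.mid = A.ps.control
        | some ev => I.LocalStep (P p) A.mid ev A.ps.control) := by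
  cases h with
  | invoke h =>
    have h' : (s.prog + 1) % 2 ≠ 0 := by omega
    simp only [ProcState.control, h, h', if_true, if_false]
    exact ⟨⟨_, rfl, .invoke _ _⟩, trivial⟩
  | ret h y ha =>
    have h' : (s.prog + 1) % 2 = 0 := by omega
    have h'' : s.prog % 2 ≠ 0 := by omega
    simp only [ProcState.control, h', h'', if_true, if_false]
    exact ⟨⟨_, rfl, .ret _ _ ha⟩, trivial⟩
  | obj h k v ha =>
    have h'' : s.prog % 2 ≠ 0 := by omega
    simp only [ProcState.control, h'', if_false]
    exact ⟨⟨_, rfl, .callObj _ _ _ ha⟩, .replyObj _ _ _⟩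
  | read h k ha =>
    have h'' : s.prog % 2 ≠ 0 := by omega
    simp only [ProcState.control, h'', if_false]
    exact ⟨⟨_, rfl, .callReg _ _ _ ha⟩, .replyReg _ _ _⟩
  | write h k a ha =>
    have h'' : s.prog % 2 ≠ 0 := by omega
    simp only [ProcState.control, h'', if_false]
    exact ⟨⟨_, rfl, .callReg _ _ _ ha⟩, .replyReg _ _ _⟩

/-- At even instants the states are those of the configuration. At odd instants the active process
is in the intermediate state of its turn, typically waiting for the answer to a call. -/
theorem follows_run (hP : P false ≠ P true) (σ : ℕ → Bool) : I.Follows (run I P w σ) := by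
  let c := config I P w σ
  let mid : ℕ → Fin n → Status × I.Loc := fun i =>
    if (c i).Skips (σ i) then (c i).control P else
      Function.update ((c i).control P) (P (σ i)) (turn I P w (σ i) ((c i).ps (σ i)) (c i).mem).mid
  refine ⟨fun j => if j % 2 = 0 then (c (j / 2)).control P else mid (j / 2), fun q => ?_,
    fun j => ?_⟩
  · simp only [Nat.zero_mod, Nat.zero_div, if_true, Config.control, c, config, initial,
      ProcState.control]
    split
    · simp_all
    · split
      · simp_all
      · rfl
  · obtain ⟨i, rfl | rfl⟩ := Nat.even_or_odd' j
    · have h1 : (2 * i + 1) % 2 ≠ 0 := by omega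
      have h2 : (2 * i + 1) / 2 = i := by omega
      have h3 : 2 * i % 2 = 0 := by omega
      have h4 : 2 * i / 2 = i := by omega
      simp only [h1, h2, h3, h4, if_true, if_false, run_even]
      by_cases hs : (c i).Skips (σ i)
      · have : firstEvent P w (σ i) (config I P w σ i) = none := if_pos hs
        rw [this]
        simp [mid, hs]
      · obtain ⟨⟨ev, hev, hstep⟩, -⟩ := (turnCase I P w (σ i) ((c i).ps (σ i)) (c i).mem).localStep
        have : firstEvent P w (σ i) (config I P w σ i) = some ev := (if_neg hs).trans hev
        rw [this]
        refine ⟨P (σ i), ?_, fun q hq => ?_⟩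
        · simp only [mid, hs, if_false, Function.update_self]
          rw [Config.control_apply hP]
          exact hstep
        · simp only [mid, hs, if_false, Function.update_of_ne hq]
    · have h1 : (2 * i + 1) % 2 ≠ 0 := by omega
      have h2 : (2 * i + 1) / 2 = i := by omega
      have h3 : (2 * i + 1 + 1) % 2 = 0 := by omega
      have h4 : (2 * i + 1 + 1) / 2 = i + 1 := by omega
      simp only [h1, h2, h3, h4, if_true, if_false, run_odd]
      by_cases hs : (c i).Skips (σ i)
      · have : secondEvent P w (σ i) (config I P w σ i) = none := if_pos hs
        rw [this]
        have h5 : c (i + 1) = c i := step_of_skips hs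
        simp [mid, hs, h5]
      · have hturn := (turnCase I P w (σ i) ((c i).ps (σ i)) (c i).mem).localStep.2
        have h6 : secondEvent P w (σ i) (config I P w σ i) =
            (turn I P w (σ i) ((c i).ps (σ i)) (c i).mem).second := if_neg hs
        have h5 : (c (i + 1)).control P = Function.update ((c i).control P) (P (σ i))
            (turn I P w (σ i) ((c i).ps (σ i)) (c i).mem).ps.control := by
          rw [← Config.control_update hP]
          exact congrArg _ (if_neg hs)
        rw [h5, h6]
        simp only [mid, hs, if_false]
        rcases hsec : (turn I P w (σ i) ((c i).ps (σ i)) (c i).mem).second with _ | ev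
        · rw [hsec] at hturn
          simp only at hturn ⊢
          rw [hturn]
        · rw [hsec] at hturn
          refine ⟨P (σ i), ?_, fun q hq => ?_⟩
          · simpa using hturn
          · simp only [Function.update_of_ne hq]

end TwoProcess

namespace TwoProcess

variable {n : ℕ} {V W : Type} [Primcodable V] [Primcodable W]
variable {I : Implementation n (DataType.fetchAndCons W) (DataType.consensus V)}
  {P : Bool → Fin n} {w : W}

/-! ### The registers are linearizable -/

section Registers

variable (I P w)

/-- The access to register `k` in the `i`-th turn, if there is one. -/
def regAccess (σ : ℕ → Bool) (k i : ℕ) : Option (Fin n × Option I.Val × Option I.Val) :=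
  match firstEvent P w (σ i) (config I P w σ i), secondEvent P w (σ i) (config I P w σ i) with
  | some (.callReg p k' x), some (.replyReg _ _ y) => if k' = k then some (p, x, y) else none
  | _, _ => none

variable {I P w}

theorem regHistory_even (σ : ℕ → Bool) (k i : ℕ) : I.regHistory (run I P w σ) k (2 * i) =
    (regAccess I P w σ k i).map fun o => .inv o.1 o.2.1 := by
  rcases step_cases (P := P) (w := w) (σ i) (config I P w σ i) with ⟨-, -, h1, h2⟩ | ⟨-, A, hA, -, h1, h2⟩
  · simp [Implementation.regHistory, regAccess, h1, h2]
  · cases hA <;> simp only [Implementation.regHistory, regAccess, run_even, h1, h2] <;>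
      (try split) <;> rfl

theorem regHistory_odd (σ : ℕ → Bool) (k i : ℕ) : I.regHistory (run I P w σ) k (2 * i + 1) =
    (regAccess I P w σ k i).map fun o => .res o.1 o.2.2 := by
  rcases step_cases (P := P) (w := w) (σ i) (config I P w σ i) with ⟨-, -, h1, h2⟩ | ⟨-, A, hA, -, h1, h2⟩
  · simp [Implementation.regHistory, regAccess, h1, h2]
  · cases hA <;> simp only [Implementation.regHistory, regAccess, run_odd, h1, h2] <;>
      (try split) <;> rfl

/-- Calls are answered at the next instant, so the contents of the register at the beginning of each
turn are a valid sequence of states. -/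
theorem linearizable_regHistory (σ : ℕ → Bool) (k : ℕ) :
    (I.regHistory (run I P w σ) k).Linearizable := by
  refine History.linearizable_of_atomic (A := regAccess I P w σ k) (regHistory_even σ k)
    (regHistory_odd σ k) (fun i => (config I P w σ i).mem.reg k) rfl ?_ ?_
  · intro i hi
    show (step P w (σ i) (config I P w σ i)).mem.reg k = _
    rcases step_cases (P := P) (w := w) (σ i) (config I P w σ i) with ⟨-, h, -⟩ | ⟨-, A, hA, h, h1, h2⟩
    · rw [h]
    · rw [h]
      cases hA with
      | invoke | ret | obj | read => rfl
      | write hs k' a ha =>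
        have : k' ≠ k := by
          intro hk
          simp [regAccess, h1, h2, hk] at hi
        exact Function.update_of_ne this.symm _ _
  · intro i p x y hi
    show _ = (y, (step P w (σ i) (config I P w σ i)).mem.reg k)
    rcases step_cases (P := P) (w := w) (σ i) (config I P w σ i) with ⟨-, h, h1, h2⟩ | ⟨-, A, hA, h, h1, h2⟩
    · simp [regAccess, h1, h2] at hi
    · rw [h]
      cases hA with
      | invoke | ret | obj => simp [regAccess, h1, h2] at hi
      | read hs k' ha =>
        by_cases hk : k' = k
        · subst hk
          simp only [regAccess, h1, h2, if_true] at hi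
          obtain ⟨-, rfl, rfl⟩ := hi
          rfl
        · simp [regAccess, h1, h2, hk] at hi
      | write hs k' a ha =>
        by_cases hk : k' = k
        · subst hk
          simp only [regAccess, h1, h2, if_true] at hi
          obtain ⟨-, rfl, rfl⟩ := hi
          simp [Memory.write, DataType.register]
        · simp [regAccess, h1, h2, hk] at hi

end Registers

/-! ### The consensus objects are eventually linearizable -/

section Objects

variable (I P w)

/-- The access to consensus object `k` in the `i`-th turn, if there is one. -/
def objAccess (σ : ℕ → Bool) (k i : ℕ) : Option (Fin n × V × V) :=
  match firstEvent P w (σ i) (config I P w σ i), secondEvent P w (σ i) (config I P w σ i) with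
  | some (.callObj p k' x), some (.replyObj _ _ y) => if k' = k then some (p, x, y) else none
  | _, _ => none

variable {I P w}

theorem objHistory_even (σ : ℕ → Bool) (k i : ℕ) : I.objHistory (run I P w σ) k (2 * i) =
    (objAccess I P w σ k i).map fun o => .inv o.1 o.2.1 := by
  rcases step_cases (P := P) (w := w) (σ i) (config I P w σ i) with ⟨-, -, h1, h2⟩ | ⟨-, A, hA, -, h1, h2⟩
  · simp [Implementation.objHistory, objAccess, h1, h2]
  · cases hA <;> simp only [Implementation.objHistory, objAccess, run_even, h1, h2] <;>
      (try split) <;> rfl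

theorem objHistory_odd (σ : ℕ → Bool) (k i : ℕ) : I.objHistory (run I P w σ) k (2 * i + 1) =
    (objAccess I P w σ k i).map fun o => .res o.1 o.2.2 := by
  rcases step_cases (P := P) (w := w) (σ i) (config I P w σ i) with ⟨-, -, h1, h2⟩ | ⟨-, A, hA, -, h1, h2⟩
  · simp [Implementation.objHistory, objAccess, h1, h2]
  · cases hA <;> simp only [Implementation.objHistory, objAccess, run_odd, h1, h2] <;>
      (try split) <;> rfl

/-- The first proposal of process `p` to object `k`, at the beginning of the `i`-th turn. -/
abbrev ownAt (I : Implementation n (DataType.fetchAndCons W) (DataType.consensus V))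
    (P : Bool → Fin n) (w : W) (σ : ℕ → Bool) (k : ℕ) (p : Bool) (i : ℕ) : Option V :=
  (config I P w σ i).mem.own p k

theorem objAccess_cases (σ : ℕ → Bool) (k i : ℕ) :
    (objAccess I P w σ k i = none ∧ ∀ p, ownAt I P w σ k p (i + 1) = ownAt I P w σ k p i) ∨
    ∃ v, objAccess I P w σ k i = some (P (σ i), v, (config I P w σ i).mem.answer (σ i) k v) ∧
      ∀ p, ownAt I P w σ k p (i + 1) =
        if p = σ i then some ((ownAt I P w σ k p i).getD v) else ownAt I P w σ k p i := by
  have hsucc : config I P w σ (i + 1) = step P w (σ i) (config I P w σ i) := rfl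
  rcases step_cases (P := P) (w := w) (σ i) (config I P w σ i) with ⟨-, h, h1, h2⟩ | ⟨-, A, hA, h, h1, h2⟩
  · exact .inl ⟨by simp [objAccess, h1, h2], fun p => by rw [ownAt, hsucc, h]⟩
  · cases hA with
    | invoke | ret | read =>
      refine .inl ⟨by simp [objAccess, h1, h2], fun p => ?_⟩
      rw [ownAt, hsucc, h]
    | write =>
      refine .inl ⟨by simp [objAccess, h1, h2], fun p => ?_⟩
      rw [ownAt, hsucc, h]
      rfl
    | obj hs k' v ha =>
      by_cases hk : k' = k
      · subst hk
        refine .inr ⟨v, by simp only [objAccess, h1, h2, if_true], fun p => ?_⟩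
        rw [ownAt, hsucc, h]
        simp [Memory.propose]
      · refine .inl ⟨by simp [objAccess, h1, h2, hk], fun p => ?_⟩
        rw [ownAt, hsucc, h]
        simp [Memory.propose, Ne.symm hk]

theorem objAccess_eq_some {σ : ℕ → Bool} {k i : ℕ} {q : Fin n} {v y : V}
    (h : objAccess I P w σ k i = some (q, v, y)) :
    q = P (σ i) ∧ y = (config I P w σ i).mem.answer (σ i) k v ∧
      ownAt I P w σ k (σ i) (i + 1) = some ((ownAt I P w σ k (σ i) i).getD v) := by
  rcases objAccess_cases (I := I) (P := P) (w := w) σ k i with ⟨h1, -⟩ | ⟨v', h1, h2⟩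
  · rw [h1] at h; cases h
  · rw [h1] at h
    simp only [Option.some.injEq, Prod.mk.injEq] at h
    obtain ⟨rfl, rfl, rfl⟩ := h
    exact ⟨rfl, rfl, by simp [h2]⟩

theorem ownAt_mono {σ : ℕ → Bool} {k : ℕ} {p : Bool} {i j : ℕ} {u : V} (hij : i ≤ j)
    (h : ownAt I P w σ k p i = some u) : ownAt I P w σ k p j = some u := by
  induction j, hij using Nat.le_induction with
  | base => exact h
  | succ j _ ih =>
    rcases objAccess_cases (I := I) (P := P) (w := w) σ k j with ⟨-, h2⟩ | ⟨v', -, h2⟩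
    · rw [h2, ih]
    · rw [h2, ih]
      simp

theorem exists_of_ownAt {σ : ℕ → Bool} {k : ℕ} {p : Bool} {i : ℕ} {u : V}
    (h : ownAt I P w σ k p i = some u) :
    ∃ b < i, ∃ y, objAccess I P w σ k b = some (P p, u, y) := by
  induction i with
  | zero => cases h
  | succ i ih =>
    by_cases hi : ownAt I P w σ k p i = some u
    · obtain ⟨b, hb, y, hy⟩ := ih hi
      exact ⟨b, by omega, y, hy⟩
    · rcases objAccess_cases (I := I) (P := P) (w := w) σ k i with ⟨-, h2⟩ | ⟨v', h1, h2⟩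
      · rw [h2] at h
        exact absurd h hi
      · have h3 := h2 p
        rw [h] at h3
        split at h3
        · rename_i hp
          subst hp
          rcases hown : ownAt I P w σ k (σ i) i with _ | u'
          · rw [hown] at h3
            simp only [Option.getD_none, Option.some.injEq] at h3
            subst h3
            exact ⟨i, by omega, _, h1⟩
          · rw [hown] at h3 hi
            exact absurd h3.symm (by simpa using hi)
        · exact absurd h3.symm hi

/-- Weak consistency: a first proposal is explained by itself, and any later answer is a recorded
first proposal, made in an earlier turn. Stabilisation: recorded entries never change, so after some
turn `N` both are final and determine all answers. -/
theorem eventuallyLinearizable_objHistory (hP : P false ≠ P true) (σ : ℕ → Bool) (k : ℕ) :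
    (I.objHistory (run I P w σ) k).EventuallyLinearizable := by
  have hinj : Function.Injective P := by
    intro p q h
    cases p <;> cases q <;> simp_all
  have hret := fun i j (y : V) (h : (I.objHistory (run I P w σ) k).Returns i j y) =>
    h.of_atomic (objHistory_even (I := I) (P := P) (w := w) σ k)
      (objHistory_odd (I := I) (P := P) (w := w) σ k)
  apply History.eventuallyLinearizable_of_decided
  · intro i j y q x hr hi
    obtain ⟨a, q', v, rfl, rfl, ha⟩ := hret i j y hr
    rw [objHistory_even, ha] at hi
    obtain ⟨rfl, rfl⟩ := ObjEvent.inv.inj (Option.some.inj hi)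
    obtain ⟨rfl, rfl, hsucc⟩ := objAccess_eq_some ha
    rcases hown : ownAt I P w σ k (σ a) a with _ | u
    · refine ⟨2 * a, by omega, P (σ a), ?_, fun _ i' hi' x' hx' => ?_⟩
      · rw [objHistory_even, ha]
        simp only [Memory.answer, hown]
        rfl
      · obtain ⟨b, rfl | rfl⟩ := Nat.even_or_odd' i'
        · rw [objHistory_even] at hx'
          simp only [Option.map_eq_some_iff, Prod.exists] at hx'
          obtain ⟨q, v', y', hb, rfl, rfl⟩ := hx'
          obtain ⟨hq, -, hb'⟩ := objAccess_eq_some hb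
          rw [← hinj hq] at hb'
          have := ownAt_mono (show b + 1 ≤ a by omega) hb'
          rw [hown] at this
          cases this
        · rw [objHistory_odd] at hx'
          simp at hx'
    · obtain ⟨p, hp⟩ : ∃ p, ownAt I P w σ k p a =
          some ((config I P w σ a).mem.answer (σ a) k v) := by
        simp only [Memory.answer, hown]
        show ∃ p, ownAt I P w σ k p a = some ((ownAt I P w σ k false a).getD u)
        rcases hf : ownAt I P w σ k false a with _ | u'
        · exact ⟨_, hown⟩
        · exact ⟨_, hf⟩
      obtain ⟨b, hb, y, hy⟩ := exists_of_ownAt hp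
      exact ⟨2 * b, by omega, P p, by rw [objHistory_even, hy]; rfl, fun h => by omega⟩
  · have hstable : ∀ p, ∃ M, ∀ i, M ≤ i → ownAt I P w σ k p i = ownAt I P w σ k p M := by
      intro p
      by_cases h : ∃ M u, ownAt I P w σ k p M = some u
      · obtain ⟨M, u, h⟩ := h
        exact ⟨M, fun i hi => by rw [h, ownAt_mono hi h]⟩
      · push Not at h
        have h' : ∀ i, ownAt I P w σ k p i = none := fun i => by
          rcases hi : ownAt I P w σ k p i with _ | u
          · rfl
          · exact absurd hi (h i u)
        exact ⟨0, fun i _ => by rw [h', h']⟩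
    choose M hM using hstable
    let N := max (M false) (M true)
    have hN : ∀ p i, N ≤ i → ownAt I P w σ k p i = ownAt I P w σ k p N := by
      intro p i hi
      have : M p ≤ N := by cases p <;> simp [N]
      rw [hM p i (this.trans hi), hM p N this]
    -- After turn `N` no proposal is a first one, as it would create an entry. Hence the answer is
    -- the entry of `false`, or that of `true` if `false` never proposes.
    have key : ∀ i j (y : V), (I.objHistory (run I P w σ) k).Returns i j y → 2 * N + 1 ≤ j →
        (ownAt I P w σ k false N <|> ownAt I P w σ k true N) = some y := by
      intro i j y hr hj
      obtain ⟨a, q', v, rfl, rfl, ha⟩ := hret i j y hr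
      obtain ⟨rfl, rfl, hsucc⟩ := objAccess_eq_some ha
      have hown : ∃ u, ownAt I P w σ k (σ a) a = some u := by
        rw [hN _ _ (show N ≤ a + 1 by omega), ← hN _ _ (show N ≤ a by omega)] at hsucc
        exact ⟨_, hsucc⟩
      obtain ⟨u, hu⟩ := hown
      have hu' := hu
      rw [hN _ _ (show N ≤ a by omega)] at hu'
      have hf := hN false _ (show N ≤ a by omega)
      simp only [Memory.answer, hu, hf]
      rcases hfN : ownAt I P w σ k false N with _ | u'
      · rcases hp : σ a with _ | _
        · rw [hp, hfN] at hu'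
          cases hu'
        · rw [hp] at hu'
          simp [hu']
      · simp
    refine ⟨2 * N + 1, fun i j i' j' y y' h h' hj hj' => ?_⟩
    have h1 := key i j y h hj
    have h2 := key i' j' y' h' hj'
    rw [h1] at h2
    exact Option.some.inj h2

end Objects

theorem isExecution_run (hP : P false ≠ P true) (σ : ℕ → Bool) :
    I.IsExecution (run I P w σ) :=
  ⟨follows_run hP σ, eventuallyLinearizable_objHistory hP σ, linearizable_regHistory σ⟩

end TwoProcess

namespace TwoProcess

variable {n : ℕ} {V W : Type} [Primcodable V] [Primcodable W]
variable {I : Implementation n (DataType.fetchAndCons W) (DataType.consensus V)}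
  {P : Bool → Fin n} {w : W}

/-! ### Progress of the processes -/

theorem step_ps_of_ne {p q : Bool} (h : q ≠ p) (c : Config I.Loc I.Val V) :
    (step P w p c).ps q = c.ps q := by
  rcases step_cases (P := P) (w := w) p c with ⟨-, h1, -⟩ | ⟨-, A, -, h1, -⟩
  · rw [h1]
  · rw [h1]
    exact Function.update_of_ne h _ _

/-- In a turn of process `p`, an operation is invoked or answered, or `prog` does not change. -/
theorem step_progress (p : Bool) (c : Config I.Loc I.Val V) :
    (((step P w p c).ps p).prog = (c.ps p).prog ∧ ((step P w p c).ps p).last = (c.ps p).last ∧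
      (∀ q x, firstEvent P w p c ≠ some (.invoke q x)) ∧
      ∀ q y, firstEvent P w p c ≠ some (.ret q y)) ∨
    ((c.ps p).prog % 2 = 0 ∧ ((step P w p c).ps p).prog = (c.ps p).prog + 1 ∧
      ((step P w p c).ps p).last = (c.ps p).last ∧
      firstEvent P w p c = some (.invoke (P p) w)) ∨
    ((c.ps p).prog % 2 = 1 ∧ ((step P w p c).ps p).prog = (c.ps p).prog + 1 ∧
      ∃ y : List W, ((step P w p c).ps p).last = y.length ∧
        firstEvent P w p c = some (.ret (P p) y)) := by
  rcases step_cases (P := P) (w := w) p c with ⟨-, h1, h2, -⟩ | ⟨-, A, hA, h1, h2, -⟩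
  · exact .inl ⟨by rw [h1], by rw [h1], by simp [h2], by simp [h2]⟩
  · rw [h1, h2]
    simp only [Function.update_self]
    cases hA with
    | invoke h => exact .inr (.inl ⟨h, rfl, rfl, rfl⟩)
    | ret h y ha => exact .inr (.inr ⟨h, rfl, y, rfl, rfl⟩)
    | obj | read | write => exact .inl ⟨rfl, rfl, by simp, by simp⟩

theorem secondEvent_ne_invoke (p : Bool) (c : Config I.Loc I.Val V) (q : Fin n) (x : W) :
    secondEvent P w p c ≠ some (.invoke q x) := by
  rcases step_cases (P := P) (w := w) p c with ⟨-, -, -, h⟩ | ⟨-, A, hA, -, -, h⟩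
  · simp [h]
  · rw [h]
    cases hA <;> simp

theorem secondEvent_ne_ret (p : Bool) (c : Config I.Loc I.Val V) (q : Fin n) (y : List W) :
    secondEvent P w p c ≠ some (.ret q y) := by
  rcases step_cases (P := P) (w := w) p c with ⟨-, -, -, h⟩ | ⟨-, A, hA, -, -, h⟩
  · simp [h]
  · rw [h]
    cases hA <;> simp

theorem firstEvent_proc {p : Bool} {c : Config I.Loc I.Val V} (h : ¬ c.Skips p) :
    ∃ ev, firstEvent P w p c = some ev ∧ ev.proc = P p := by
  rcases step_cases (P := P) (w := w) p c with ⟨h', -⟩ | ⟨-, A, hA, -, h, -⟩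
  · exact absurd h' h
  · rw [h]
    cases hA <;> exact ⟨_, rfl, rfl⟩

theorem prog_le_step (p q : Bool) (c : Config I.Loc I.Val V) :
    (c.ps q).prog ≤ ((step P w p c).ps q).prog ∧
      ((step P w p c).ps q).prog ≤ (c.ps q).prog + 1 := by
  by_cases h : q = p
  · subst h
    rcases step_progress (P := P) (w := w) q c with h | h | h <;> omega
  · rw [step_ps_of_ne h]
    omega

theorem last_step {p q : Bool} {c : Config I.Loc I.Val V}
    (h : ((step P w p c).ps q).prog = (c.ps q).prog) :
    ((step P w p c).ps q).last = (c.ps q).last := by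
  by_cases hq : q = p
  · subst hq
    rcases step_progress (P := P) (w := w) q c with h' | h' | h'
    · exact h'.2.1
    · omega
    · omega
  · rw [step_ps_of_ne hq]

theorem prog_mono (σ : ℕ → Bool) (p : Bool) :
    Monotone fun i => ((config I P w σ i).ps p).prog :=
  monotone_nat_of_le_succ fun i => (prog_le_step (σ i) p _).1

theorem config_congr {σ τ : ℕ → Bool} {i : ℕ} (h : ∀ j < i, σ j = τ j) :
    config I P w σ i = config I P w τ i := by
  induction i with
  | zero => rfl
  | succ i ih =>
    rw [config, config, ih fun j hj => h j (by omega), h i (by omega)]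

variable (P w) in
def Reachable (c : Config I.Loc I.Val V) : Prop := ∃ σ i, config I P w σ i = c

/-- A configuration depends only on the turns before it, so any infinite schedule may follow. Facts
about executions, wait-freedom above all, thereby apply from every reachable configuration. -/
theorem Reachable.splice {c : Config I.Loc I.Val V} (h : Reachable P w c) (τ : ℕ → Bool) :
    ∃ σ i, config I P w σ i = c ∧ ∀ j, σ (i + j) = τ j := by
  obtain ⟨σ, i, rfl⟩ := h
  refine ⟨fun j => if j < i then σ j else τ (j - i), i, ?_, fun j => ?_⟩
  · exact config_congr fun j hj => by simp [hj]
  · simp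

variable (P w) in
/-- The configuration reached from `c` by a finite schedule. -/
def runList (l : List Bool) (c : Config I.Loc I.Val V) : Config I.Loc I.Val V :=
  l.foldl (fun c p => step P w p c) c

@[simp] theorem runList_nil (c : Config I.Loc I.Val V) : runList P w [] c = c := rfl

@[simp] theorem runList_cons (p : Bool) (l : List Bool) (c : Config I.Loc I.Val V) :
    runList P w (p :: l) c = runList P w l (step P w p c) := rfl

theorem runList_append (l l' : List Bool) (c : Config I.Loc I.Val V) :
    runList P w (l ++ l') c = runList P w l' (runList P w l c) := List.foldl_append

theorem config_add_length {σ : ℕ → Bool} {i : ℕ} {l : List Bool}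
    (h : ∀ j (hj : j < l.length), σ (i + j) = l[j]) :
    config I P w σ (i + l.length) = runList P w l (config I P w σ i) := by
  induction l generalizing i with
  | nil => rfl
  | cons p l ih =>
    have h0 := h 0 (by simp)
    simp only [add_zero, List.getElem_cons_zero] at h0
    have : i + (p :: l).length = (i + 1) + l.length := by simp; omega
    rw [this, ih]
    · rw [runList_cons, ← h0]
      rfl
    · intro j hj
      have := h (j + 1) (by simpa using hj)
      simpa [add_assoc, add_comm 1 j] using this

theorem Reachable.runList {c : Config I.Loc I.Val V} (h : Reachable P w c) (l : List Bool) :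
    Reachable P w (runList P w l c) := by
  obtain ⟨σ, i, rfl, hσ⟩ := h.splice fun j => l.getD j false
  refine ⟨σ, i + l.length, config_add_length fun j hj => ?_⟩
  rw [hσ, List.getD_eq_getElem _ _ hj]

theorem prog_le_runList (l : List Bool) (q : Bool) (c : Config I.Loc I.Val V) :
    (c.ps q).prog ≤ ((runList P w l c).ps q).prog := by
  induction l generalizing c with
  | nil => rfl
  | cons p l ih => exact (prog_le_step p q c).1.trans (ih _)

theorem last_runList {l : List Bool} {q : Bool} {c : Config I.Loc I.Val V}
    (h : ((runList P w l c).ps q).prog = (c.ps q).prog) :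
    ((runList P w l c).ps q).last = (c.ps q).last := by
  induction l generalizing c with
  | nil => rfl
  | cons p l ih =>
    have h1 := (prog_le_step (P := P) (w := w) p q c).1
    have h2 := prog_le_runList (P := P) (w := w) l q (step P w p c)
    rw [runList_cons] at h ⊢
    rw [ih (by omega), last_step (by omega)]

theorem runList_replicate_ps {p q : Bool} (h : q ≠ p) (a : ℕ) (c : Config I.Loc I.Val V) :
    (runList P w (List.replicate a p) c).ps q = c.ps q := by
  induction a generalizing c with
  | zero => rfl
  | succ a ih => rw [List.replicate_succ, runList_cons, ih, step_ps_of_ne h]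

theorem not_skips {m : ℕ} {p : Bool} {c : Config I.Loc I.Val V}
    (h : (c.ps p).prog ≤ 2 * m + 1) (h' : 2 * m ≤ (c.ps (!p)).prog) : ¬ c.Skips p := by
  rintro ⟨h1, h2⟩
  omega

/-- A process within an operation has invoked it, and has not returned since. -/
theorem exists_invoke {σ : ℕ → Bool} {p : Bool} {N : ℕ}
    (h : ((config I P w σ N).ps p).prog % 2 = 1) :
    ∃ a < N, σ a = p ∧ ((config I P w σ a).ps p).prog < ((config I P w σ N).ps p).prog ∧
      firstEvent P w p (config I P w σ a) = some (.invoke (P p) w) ∧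
      ∀ i, a < i → i ≤ N →
        ((config I P w σ i).ps p).prog = ((config I P w σ N).ps p).prog := by
  induction N with
  | zero => simp [config, initial] at h
  | succ N ih =>
    have hsucc : config I P w σ (N + 1) = step P w (σ N) (config I P w σ N) := rfl
    by_cases heq : ((config I P w σ (N + 1)).ps p).prog = ((config I P w σ N).ps p).prog
    · rw [heq] at h
      obtain ⟨a, ha, hp, hlt, hev, hi⟩ := ih h
      refine ⟨a, by omega, hp, by omega, hev, fun i hai hiN => ?_⟩
      rcases hiN.lt_or_eq with h' | rfl
      · rw [heq]
        exact hi i hai (by omega)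
      · rfl
    · have hp : σ N = p := by
        by_contra hne
        rw [hsucc, step_ps_of_ne (Ne.symm hne)] at heq
        exact heq rfl
      rw [hsucc, hp] at h heq
      refine ⟨N, by omega, hp, ?_, ?_, fun i h1 h2 => ?_⟩
      · rw [hsucc, hp]
        have := (prog_le_step (P := P) (w := w) p p (config I P w σ N)).1
        omega
      · rcases step_progress (P := P) (w := w) p (config I P w σ N) with h' | h' | h'
        · omega
        · exact h'.2.2.2
        · omega
      · obtain rfl : i = N + 1 := by omega
        rfl

/-- Under a wait-free implementation, a process with infinitely many turns completes its operation. -/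
theorem no_starvation (hP : P false ≠ P true) (hwf : I.WaitFree) {σ : ℕ → Bool} {p : Bool}
    {N m : ℕ} (hconst : ∀ i, N ≤ i → ((config I P w σ i).ps p).prog / 2 = m)
    (hinf : ∀ M, ∃ i, M ≤ i ∧ σ i = p ∧ ¬ (config I P w σ i).Skips p) : False := by
  have hinj : ∀ q, P q = P p → q = p := by
    intro q h
    cases p <;> cases q <;> simp_all
  have hmono := prog_mono (I := I) (P := P) (w := w) σ p
  -- At its first effective turn after `N` the process is inside an operation or invokes one. As
  -- `prog / 2` is constant, an odd `prog` can no longer change: the operation stays pending.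
  obtain ⟨N', hNN', hodd⟩ : ∃ N', N ≤ N' ∧ ((config I P w σ N').ps p).prog % 2 = 1 := by
    obtain ⟨i, hi, hp, hskip⟩ := hinf N
    rcases step_cases (P := P) (w := w) p (config I P w σ i) with ⟨h, -⟩ | ⟨-, A, hA, h, -⟩
    · exact absurd h hskip
    · have hsucc : config I P w σ (i + 1) = step P w p (config I P w σ i) := by rw [config, hp]
      cases hA with
      | invoke h' =>
        refine ⟨i + 1, by omega, ?_⟩
        rw [hsucc, h]
        simp only [Function.update_self]
        omega
      | ret h' | obj h' | read h' | write h' => exact ⟨i, hi, h'⟩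
  have hlater : ∀ i, N' ≤ i →
      ((config I P w σ i).ps p).prog = ((config I P w σ N').ps p).prog := by
    intro i hi
    have h1 : ((config I P w σ N').ps p).prog ≤ ((config I P w σ i).ps p).prog := hmono hi
    have h2 := hconst i (by omega)
    have h3 := hconst N' hNN'
    omega
  obtain ⟨a, ha, hp, -, hev, hbetween⟩ := exists_invoke hodd
  have hconst' : ∀ i, a < i →
      ((config I P w σ i).ps p).prog = ((config I P w σ N').ps p).prog := by
    intro i hi
    rcases le_total i N' with h | h
    · exact hbetween i hi h
    · exact hlater i h
  rcases hwf _ (isExecution_run hP σ) (2 * a) (P p) w (by rw [run_even, hp, hev]) with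
    ⟨j, y, hj, hy⟩ | ⟨M, hM⟩
  · obtain ⟨b, rfl | rfl⟩ := Nat.even_or_odd' j
    · rw [run_even] at hy
      rcases step_progress (P := P) (w := w) (σ b) (config I P w σ b) with h | h | ⟨-, h, y', -, h'⟩
      · exact absurd hy (h.2.2.2 _ _)
      · rw [h.2.2.2] at hy
        cases hy
      · rw [h'] at hy
        have hpb := hinj _ (SysEvent.ret.inj (Option.some.inj hy)).1
        rw [hpb] at h
        have h1 := hconst' b (by omega)
        have h2 := hconst' (b + 1) (by omega)
        rw [config, hpb] at h2
        omega
    · rw [run_odd] at hy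
      exact secondEvent_ne_ret _ _ _ _ hy
  · obtain ⟨i, hi, hpi, hskip⟩ := hinf M
    obtain ⟨ev, hev', hproc⟩ := firstEvent_proc (P := P) (w := w) hskip
    exact hM (2 * i) (by omega) ev (by rw [run_even, hpi, hev']) hproc

/-- A process that runs alone completes its operation. -/
theorem exists_solo (hP : P false ≠ P true) (hwf : I.WaitFree) {c : Config I.Loc I.Val V}
    (hc : Reachable P w c) {p : Bool} {m : ℕ} (h0 : 2 * m ≤ (c.ps p).prog)
    (h1 : (c.ps p).prog ≤ 2 * m + 2) (h2 : 2 * m ≤ (c.ps (!p)).prog) :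
    ∃ a, ((runList P w (List.replicate a p) c).ps p).prog = 2 * m + 2 := by
  by_contra hcon
  push Not at hcon
  -- `prog` grows by at most one per turn, so it cannot jump over the value `2 * m + 2` that it
  -- never takes.
  have hlt : ∀ a, ((runList P w (List.replicate a p) c).ps p).prog ≤ 2 * m + 1 := by
    intro a
    induction a with
    | zero =>
      have := hcon 0
      simp only [List.replicate_zero, runList_nil] at this ⊢
      omega
    | succ a ih =>
      have := hcon (a + 1)
      rw [List.replicate_succ', runList_append] at this ⊢
      have h := (prog_le_step (P := P) (w := w) p p (runList P w (List.replicate a p) c)).2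
      simp only [runList_cons, runList_nil] at this ⊢
      omega
  obtain ⟨σ, i, rfl, hσ⟩ := hc.splice fun _ => p
  have hrun : ∀ a, config I P w σ (i + a) =
      runList P w (List.replicate a p) (config I P w σ i) := by
    intro a
    have := config_add_length (I := I) (P := P) (w := w) (σ := σ) (i := i)
      (l := List.replicate a p) (fun j _ => by simp [hσ])
    simpa using this
  refine no_starvation (w := w) hP hwf (σ := σ) (p := p) (N := i) (m := m) ?_ ?_
  · intro j hj
    obtain ⟨a, rfl⟩ := Nat.exists_eq_add_of_le hj
    have h3 := hlt a
    have h4 := prog_le_runList (P := P) (w := w) (List.replicate a p) p (config I P w σ i)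
    rw [← hrun] at h3 h4
    omega
  · intro M
    refine ⟨i + M, by omega, hσ M, not_skips (m := m) ?_ ?_⟩
    · rw [hrun]
      exact hlt M
    · rw [hrun, runList_replicate_ps (by simp)]
      exact h2

/-! ### The effect of turns on the memory -/

/-- The changes that process `p` can make to the memory. -/
inductive Modifies {Val V : Type} (p : Bool) : (Memory Val V → Memory Val V) → Prop
  | write (k : ℕ) (a : Val) : Modifies p fun m => m.write k a
  | propose (k : ℕ) (v : V) : Modifies p fun m => m.propose p k v

theorem Modifies.own {Val V : Type} {p q : Bool} {f : Memory Val V → Memory Val V}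
    (hf : Modifies q f) (hpq : p ≠ q) (m : Memory Val V) : (f m).own p = m.own p := by
  cases hf with
  | write k a => rfl
  | propose k v =>
    funext j
    simp [Memory.propose, hpq]

/-- Changes by different processes commute, or the later one overwrites the earlier one. -/
theorem Modifies.comm {Val V : Type} {p q : Bool} {f g : Memory Val V → Memory Val V}
    (hf : Modifies p f) (hg : Modifies q g) (hpq : p ≠ q) (m : Memory Val V) :
    f (g m) = g (f m) ∨ f (g m) = f m := by
  cases hf with
  | write k a =>
    cases hg with
    | write k' a' =>
      by_cases hk : k = k'
      · subst hk
        right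
        simp [Memory.write]
      · left
        simp only [Memory.write]
        rw [Function.update_comm hk]
    | propose k' v' => exact .inl rfl
  | propose k v =>
    cases hg with
    | write k' a' => exact .inl rfl
    | propose k' v' =>
      left
      simp only [Memory.propose, Memory.mk.injEq, true_and]
      funext r j
      by_cases h1 : r = p
      · have h2 : r ≠ q := h1 ▸ hpq
        simp [h2]
      · simp [h1]

/-- A turn leaves the memory unchanged, or it changes it regardless of what the other process
does. -/
theorem turn_effect (p : Bool) (s : ProcState I.Loc) (m : Memory I.Val V) :
    (turn I P w p s m).mem = m ∨ ∃ f s', Modifies p f ∧ ∀ m' : Memory I.Val V,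
      m'.own p = m.own p → (turn I P w p s m').ps = s' ∧ (turn I P w p s m').mem = f m' := by
  by_cases hs : s.prog % 2 = 0
  · left
    simp [turn, hs]
  · rcases ha : I.action (P p) s.loc with y | ⟨k, v⟩ | ⟨k, _ | a⟩
    · left
      simp [turn, hs, ha]
    · rcases hown : m.own p k with _ | u
      -- A first proposal is answered by its own value, so the new local state does not depend on
      -- the rest of the memory.
      · right
        refine ⟨_, ⟨I.onObjReply (P p) s.loc v, s.prog, s.last⟩, .propose k v, fun m' hm' => ?_⟩
        rw [← hm'] at hown
        simp only [turn, hs, ha, Memory.answer, hown, if_false]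
        exact ⟨trivial, rfl⟩
      -- The entry exists already, and proposing again leaves it as it is: the access only reads.
      · left
        simp only [turn, hs, ha, if_false]
        obtain ⟨r, o⟩ := m
        simp only [Memory.propose, Memory.mk.injEq, true_and]
        funext q j
        split
        · rename_i h
          obtain ⟨rfl, rfl⟩ := h
          simp only at hown
          rw [hown]
          rfl
        · rfl
    · left
      simp [turn, hs, ha]
    · right
      refine ⟨_, ⟨I.onRegReply (P p) s.loc none, s.prog, s.last⟩, .write k a, fun m' _ => ?_⟩
      simp [turn, hs, ha]

end TwoProcess

namespace TwoProcess

variable {n : ℕ} {V W : Type} [Primcodable V] [Primcodable W]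
variable {I : Implementation n (DataType.fetchAndCons W) (DataType.consensus V)}
  {P : Bool → Fin n} {w : W}

/-! ### Rounds -/

/-- Both processes are idle after `m` operations each. -/
def Config.Quiet (m : ℕ) (c : Config I.Loc I.Val V) : Prop := ∀ p, (c.ps p).prog = 2 * m

/-- The schedule `l` makes the processes run one after the other, starting with `p`. -/
def Sequential (p : Bool) (l : List Bool) : Prop :=
  ∃ a b, l = List.replicate a p ++ List.replicate b (!p)

/-- The answers in the round `m` with schedule `l`, which ends in `c`, are those of a linearizable
object on which each process has performed `m` operations before. -/
structure GoodRound (m : ℕ) (l : List Bool) (c : Config I.Loc I.Val V) : Prop where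
  values : ∀ p, (c.ps p).last = 2 * m ∨ (c.ps p).last = 2 * m + 1
  ne : (c.ps false).last ≠ (c.ps true).last
  sequential : ∀ p, Sequential p l → (c.ps p).last < (c.ps (!p)).last

theorem GoodRound.eq_iff {m : ℕ} {l : List Bool} {c : Config I.Loc I.Val V}
    (h : GoodRound m l c) (p : Bool) :
    (c.ps p).last = 2 * m ↔ (c.ps (!p)).last = 2 * m + 1 := by
  have h1 := h.values p
  have h2 := h.values (!p)
  have h3 := h.ne
  cases p <;> simp only [Bool.not_true, Bool.not_false] at * <;> omega

variable (P w) in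
/-- Process `b` may win the round `m` from configuration `c`. -/
def MayWin (m : ℕ) (c : Config I.Loc I.Val V) (b : Bool) : Prop :=
  ∃ l, (runList P w l c).Quiet m.succ ∧ ((runList P w l c).ps b).last = 2 * m

theorem MayWin.of_step {m : ℕ} {c : Config I.Loc I.Val V} {b p : Bool}
    (h : MayWin P w m (step P w p c) b) : MayWin P w m c b := by
  obtain ⟨l, h⟩ := h
  exact ⟨p :: l, h⟩

/-- Let `b` run alone to completion, then the other process. The schedule is sequential, so in a
good round `b` gets the shorter list. -/
theorem exists_mayWin_both (hP : P false ≠ P true) (hwf : I.WaitFree) {D : Config I.Loc I.Val V}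
    {m : ℕ} (hD : Reachable P w D) (hq : D.Quiet m)
    (hgood : ∀ l, (runList P w l D).Quiet m.succ → GoodRound m l (runList P w l D)) (b : Bool) :
    MayWin P w m D b := by
  obtain ⟨a, ha⟩ := exists_solo hP hwf hD (p := b) (m := m) (by rw [hq]) (by rw [hq]; omega)
    (by rw [hq])
  have hother := runList_replicate_ps (P := P) (w := w) (show (!b) ≠ b by simp) a D
  obtain ⟨a', ha'⟩ := exists_solo hP hwf (hD.runList (List.replicate a b)) (p := !b) (m := m)
    (by rw [hother, hq]) (by rw [hother, hq]; omega) (by rw [Bool.not_not, ha]; omega)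
  have hb := runList_replicate_ps (P := P) (w := w) (show b ≠ !b by simp) a'
    (runList P w (List.replicate a b) D)
  rw [← runList_append] at ha' hb
  have hquiet : (runList P w (List.replicate a b ++ List.replicate a' !b) D).Quiet m.succ := by
    intro q
    by_cases h : q = b
    · subst h
      rw [hb, ha]
      rfl
    · obtain rfl : q = !b := by cases q <;> cases b <;> simp_all
      rw [ha']
      rfl
  refine ⟨_, hquiet, ?_⟩
  have hg := hgood _ hquiet
  have h1 := hg.sequential b ⟨a, a', rfl⟩
  have h2 := hg.values b
  have h3 := hg.values (!b)
  omega

/-- Completing the round with solo runs, first of process `p`. -/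
theorem exists_complete (hP : P false ≠ P true) (hwf : I.WaitFree) {m a : ℕ} {p : Bool}
    {c c' : Config I.Loc I.Val V} (hc : Reachable P w c) (hc' : Reachable P w c')
    (hm : ∀ q, 2 * m ≤ (c.ps q).prog) (hm' : ∀ q, 2 * m ≤ (c'.ps q).prog)
    (hle : ∀ q, (c.ps q).prog ≤ 2 * m + 2) (hle' : ∀ q, (c'.ps q).prog ≤ 2 * m + 2)
    (hps : c.ps p = c'.ps p) (hmem : c.mem = c'.mem)
    (ha : ((runList P w (List.replicate a p) c).ps p).prog = 2 * m + 2) :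
    ∃ l l', (runList P w l c).Quiet m.succ ∧ (runList P w l' c').Quiet m.succ ∧
      ((runList P w l c).ps p).last = ((runList P w l' c').ps p).last := by
  have done : ∀ d : Config I.Loc I.Val V, Reachable P w d → (d.ps p).prog = 2 * m + 2 →
      (∀ q, 2 * m ≤ (d.ps q).prog) → (∀ q, (d.ps q).prog ≤ 2 * m + 2) →
      ∃ l, (runList P w l d).Quiet m.succ ∧ (runList P w l d).ps p = d.ps p := by
    intro d hd hp h1 h2
    obtain ⟨b, hb⟩ := exists_solo hP hwf hd (p := !p) (m := m) (h1 _) (h2 _)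
      (by rw [Bool.not_not, hp]; omega)
    have hother := runList_replicate_ps (P := P) (w := w) (show p ≠ !p by simp) b d
    refine ⟨_, fun q => ?_, hother⟩
    by_cases h : q = p
    · subst h
      rw [hother, hp]
      rfl
    · obtain rfl : q = !p := by cases q <;> cases p <;> simp_all
      rw [hb]
      rfl
  induction a generalizing c c' with
  | zero =>
    obtain ⟨l, hl, hpl⟩ := done c hc ha hm hle
    obtain ⟨l', hl', hpl'⟩ := done c' hc' (hps ▸ ha) hm' hle'
    exact ⟨l, l', hl, hl', by rw [hpl, hpl', hps]⟩
  | succ a ih =>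
    by_cases hdone : (c.ps p).prog = 2 * m + 2
    · obtain ⟨l, hl, hpl⟩ := done c hc hdone hm hle
      obtain ⟨l', hl', hpl'⟩ := done c' hc' (hps ▸ hdone) hm' hle'
      exact ⟨l, l', hl, hl', by rw [hpl, hpl', hps]⟩
    · have hlt := hle p
      have hlt' := hle' p
      have hs : ¬ c.Skips p := not_skips (m := m) (by omega) (hm _)
      have hs' : ¬ c'.Skips p := not_skips (m := m) (by rw [← hps]; omega) (hm' _)
      have e1 : step P w p c = _ := if_neg hs
      have e2 : step P w p c' = _ := if_neg hs'
      have hprog := prog_le_step (P := P) (w := w) p p c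
      have hprog' := prog_le_step (P := P) (w := w) p p c'
      have hbound : ∀ q, ((step P w p c).ps q).prog ≤ 2 * m + 2 := by
        intro q
        by_cases h : q = p
        · subst h
          omega
        · rw [step_ps_of_ne h]
          exact hle q
      have hbound' : ∀ q, ((step P w p c').ps q).prog ≤ 2 * m + 2 := by
        intro q
        by_cases h : q = p
        · subst h
          rw [← hps] at hprog'
          omega
        · rw [step_ps_of_ne h]
          exact hle' q
      obtain ⟨l, l', h⟩ := ih (c := step P w p c) (c' := step P w p c') (hc.runList [p])
        (hc'.runList [p]) (fun q => (hm q).trans (prog_le_step p q c).1)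
        (fun q => (hm' q).trans (prog_le_step p q c').1) hbound hbound'
        (by rw [e1, e2]; simp [hps, hmem]) (by rw [e1, e2]; simp [hps, hmem]) ha
      exact ⟨p :: l, p :: l', h⟩

/-! ### The valency argument within one round -/

section Valency

variable {D : Config I.Loc I.Val V} {m : ℕ}

/-- Two configurations that look the same to process `p` have a possible winner in common. -/
theorem exists_common_winner (hP : P false ≠ P true) (hwf : I.WaitFree) (hD : Reachable P w D)
    (hgood : ∀ l, (runList P w l D).Quiet m.succ → GoodRound m l (runList P w l D))
    {k k' : List Bool} {c c' : Config I.Loc I.Val V} (hc : c = runList P w k D)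
    (hc' : c' = runList P w k' D) {p : Bool}
    (hm : ∀ q, 2 * m ≤ (c.ps q).prog) (hm' : ∀ q, 2 * m ≤ (c'.ps q).prog)
    (hle : ∀ q, (c.ps q).prog ≤ 2 * m + 2) (hle' : ∀ q, (c'.ps q).prog ≤ 2 * m + 2)
    (hps : c.ps p = c'.ps p) (hmem : c.mem = c'.mem) :
    ∃ b, MayWin P w m c b ∧ MayWin P w m c' b := by
  have hr : Reachable P w c := hc ▸ hD.runList k
  have hr' : Reachable P w c' := hc' ▸ hD.runList k'
  obtain ⟨a, ha⟩ := exists_solo hP hwf hr (hm p) (hle p) (hm _)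
  obtain ⟨l, l', hl, hl', hlast⟩ := exists_complete hP hwf hr hr' hm hm' hle hle' hps hmem ha
  have hg : GoodRound m (k ++ l) (runList P w l c) := by
    rw [hc, ← runList_append] at hl ⊢
    exact hgood _ hl
  have hg' : GoodRound m (k' ++ l') (runList P w l' c') := by
    rw [hc', ← runList_append] at hl' ⊢
    exact hgood _ hl'
  rcases hg.values p with h | h
  · exact ⟨p, ⟨l, hl, h⟩, l', hl', hlast ▸ h⟩
  -- The answer of `p` alone determines the winner of a good round, so if `p` loses in both
  -- completions, the other process wins in both.
  · have h1 := (hg.eq_iff (!p)).2 (by rwa [Bool.not_not])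
    have h2 := (hg'.eq_iff (!p)).2 (by rwa [Bool.not_not, ← hlast])
    exact ⟨!p, ⟨l, hl, h1⟩, l', hl', h2⟩

variable (P w D m) in
/-- A configuration reachable from `D` in which both processes may win the round. -/
def Bivalent (c : Config I.Loc I.Val V) : Prop :=
  (∃ k, c = runList P w k D) ∧ ∀ b, MayWin P w m c b

/-- A process that has completed its operation has a fixed answer, which already determines the
winner. -/
theorem Bivalent.prog_le
    (hgood : ∀ l, (runList P w l D).Quiet m.succ → GoodRound m l (runList P w l D))
    {c : Config I.Loc I.Val V} (h : Bivalent P w D m c) (p : Bool) :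
    (c.ps p).prog ≤ 2 * m + 1 := by
  obtain ⟨⟨k, rfl⟩, hwin⟩ := h
  obtain ⟨l, hl, hlast⟩ := hwin p
  obtain ⟨l', hl', hlast'⟩ := hwin !p
  by_contra hcon
  have h1 := prog_le_runList (P := P) (w := w) l p (runList P w k D)
  have h2 := prog_le_runList (P := P) (w := w) l' p (runList P w k D)
  have e1 := hl p
  have e2 := hl' p
  have f1 := last_runList (P := P) (w := w) (l := l) (q := p) (c := runList P w k D) (by omega)
  have f2 := last_runList (P := P) (w := w) (l := l') (q := p) (c := runList P w k D) (by omega)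
  rw [← runList_append] at hl'
  have hg := (hgood _ hl').eq_iff !p
  rw [runList_append, Bool.not_not] at hg
  have := hg.1 hlast'
  omega

/-- Whatever the two pending turns do, some configuration after the turn of `p` and one after the
turn of `!p` look alike to one process, so they share a possible winner by `exists_common_winner`.
-/
theorem not_critical (hP : P false ≠ P true) (hwf : I.WaitFree) (hD : Reachable P w D)
    (hgood : ∀ l, (runList P w l D).Quiet m.succ → GoodRound m l (runList P w l D))
    {k : List Bool} {c : Config I.Loc I.Val V} (hc : c = runList P w k D)
    (hm : ∀ q, 2 * m ≤ (c.ps q).prog) (hle : ∀ q, (c.ps q).prog ≤ 2 * m + 1) {p : Bool}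
    {b : Bool} (h : ∀ x, MayWin P w m (step P w p c) x → x = b)
    (h' : ∀ x, MayWin P w m (step P w (!p) c) x → x ≠ b) : False := by
  have reach : ∀ l, runList P w l c = runList P w (k ++ l) D := fun l => by
    rw [runList_append, hc]
  have hne : p ≠ !p := by simp
  have m1 : ∀ l q, 2 * m ≤ ((runList P w l c).ps q).prog := fun l q =>
    (hm q).trans (prog_le_runList l q c)
  have l1 : ∀ r q, ((step P w r c).ps q).prog ≤ 2 * m + 2 := fun r q =>
    ((prog_le_step r q c).2).trans (by have := hle q; omega)
  have l2 : ∀ r q, ((step P w (!r) (step P w r c)).ps q).prog ≤ 2 * m + 2 := by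
    intro r q
    by_cases hq : q = !r
    · subst hq
      refine ((prog_le_step (!r) (!r) _).2).trans ?_
      rw [step_ps_of_ne (by simp)]
      have := hle (!r)
      omega
    · rw [step_ps_of_ne hq]
      exact l1 r q
  have hs : ∀ r, ¬ c.Skips r := fun r => not_skips (hle r) (hm _)
  have hs2 : ∀ r, ¬ (step P w r c).Skips (!r) := fun r =>
    not_skips (m := m) (by rw [step_ps_of_ne (by simp)]; exact hle _) (m1 [r] _)
  have e : ∀ r, step P w r c = ⟨Function.update c.ps r (turn I P w r (c.ps r) c.mem).ps,
      (turn I P w r (c.ps r) c.mem).mem⟩ := fun r => if_neg (hs r)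
  have e2 : ∀ r, step P w (!r) (step P w r c) =
      ⟨Function.update (step P w r c).ps (!r)
        (turn I P w (!r) (c.ps (!r)) (turn I P w r (c.ps r) c.mem).mem).ps,
      (turn I P w (!r) (c.ps (!r)) (turn I P w r (c.ps r) c.mem).mem).mem⟩ := fun r => by
    rw [step, if_neg (hs2 r), step_ps_of_ne (show (!r) ≠ r by simp)]
    simp only [e r]
  have key : ∀ r x, MayWin P w m (step P w r c) x → ¬ MayWin P w m (step P w (!r) c) x := by
    intro r x h1 h2
    by_cases hr : r = p
    · subst hr
      exact h' x h2 (h x h1)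
    · obtain rfl : r = !p := by cases r <;> cases p <;> simp_all
      rw [Bool.not_not] at h2
      exact h' x h1 (h x h2)
  -- If the turn of `r` does not change the memory, the other process cannot tell whether it took
  -- place before its own turn.
  have read : ∀ r, (turn I P w r (c.ps r) c.mem).mem = c.mem → False := by
    intro r hr
    obtain ⟨x, h1, h2⟩ := exists_common_winner hP hwf hD hgood (p := !r)
      (c := step P w (!r) c) (c' := step P w (!r) (step P w r c)) (reach [!r]) (reach [r, !r])
      (m1 [!r]) (m1 [r, !r]) (l1 _) (l2 _) (by rw [e2, e]; simp [hr]) (by rw [e2, e]; simp [hr])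
    exact key r x h2.of_step h1
  rcases turn_effect (I := I) (P := P) (w := w) p (c.ps p) c.mem with h1 | ⟨f, s, hf, hfs⟩
  · exact read p h1
  rcases turn_effect (I := I) (P := P) (w := w) (!p) (c.ps (!p)) c.mem with h1 | ⟨g, t, hg, hgt⟩
  · exact read (!p) h1
  obtain ⟨hp1, hp2⟩ := hfs c.mem rfl
  obtain ⟨hq1, hq2⟩ := hgt c.mem rfl
  obtain ⟨hp3, hp4⟩ := hfs (g c.mem) (hg.own hne _)
  obtain ⟨hq3, hq4⟩ := hgt (f c.mem) (hf.own hne.symm _)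
  have e3 := e2 p
  have e4 := e2 (!p)
  rw [Bool.not_not] at e4
  rcases hf.comm hg hne c.mem with hcomm | hcomm
  -- Commuting changes: both orders of the two turns give the same memory and the same state of `p`.
  · obtain ⟨x, h1, h2⟩ := exists_common_winner hP hwf hD hgood (p := p)
      (c := step P w (!p) (step P w p c)) (c' := step P w p (step P w (!p) c))
      (reach [p, !p]) (reach [!p, p]) (m1 [p, !p]) (m1 [!p, p]) (l2 _)
      (by have := l2 (!p); rwa [Bool.not_not] at this)
      (by rw [step_ps_of_ne hne, e4, e p]; simp [hq2, hp3, hp1])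
      (by rw [e3, e4]; simp [hp2, hq2, hp4, hq4, hcomm])
    exact key p x h1.of_step h2.of_step
  -- Overwriting: the write of `p` erases the trace of the other process, so `p` cannot tell whether
  -- the latter moved first.
  · obtain ⟨x, h1, h2⟩ := exists_common_winner hP hwf hD hgood (p := p)
      (c := step P w p c) (c' := step P w p (step P w (!p) c))
      (reach [p]) (reach [!p, p]) (m1 [p]) (m1 [!p, p]) (l1 _)
      (by have := l2 (!p); rwa [Bool.not_not] at this)
      (by rw [e4, e p]; simp [hq2, hp3, hp1])
      (by rw [e4, e p]; simp [hp2, hq2, hp4, hcomm])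
    exact key p x h1 h2.of_step

/-- Each process wins after a suitable first turn. If neither successor were bivalent, these first
turns would belong to different processes and decide oppositely: a critical configuration. -/
theorem Bivalent.exists_step (hP : P false ≠ P true) (hwf : I.WaitFree) (hD : Reachable P w D)
    (hq : D.Quiet m)
    (hgood : ∀ l, (runList P w l D).Quiet m.succ → GoodRound m l (runList P w l D))
    {c : Config I.Loc I.Val V} (hc : Bivalent P w D m c) :
    ∃ p, Bivalent P w D m (step P w p c) := by
  by_contra hcon
  push Not at hcon
  obtain ⟨k, hk⟩ := hc.1
  have hwin : ∀ b, ∃ q, MayWin P w m (step P w q c) b := by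
    intro b
    obtain ⟨l, hl, hb⟩ := hc.2 b
    cases l with
    | nil =>
      have h1 := hl false
      have h2 := hc.prog_le hgood false
      simp only [runList_nil] at h1
      omega
    | cons q l => exact ⟨q, l, hl, hb⟩
  have hnot : ∀ q, ¬ (MayWin P w m (step P w q c) false ∧ MayWin P w m (step P w q c) true) := by
    rintro q ⟨h1, h2⟩
    refine hcon q ⟨⟨k ++ [q], by rw [runList_append, ← hk]; rfl⟩, fun b => ?_⟩
    cases b
    · exact h1
    · exact h2
  obtain ⟨q, hqf⟩ := hwin false
  obtain ⟨q', hqt⟩ := hwin true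
  have hqq : q' = !q := by
    by_contra hne
    obtain rfl : q' = q := by cases q <;> cases q' <;> simp_all
    exact hnot q' ⟨hqf, hqt⟩
  subst hqq
  refine not_critical hP hwf hD hgood hk (fun r => ?_) (hc.prog_le hgood) (p := q) (b := false)
    (fun x hx => ?_) (fun x hx => ?_)
  · rw [hk, ← hq r]
    exact prog_le_runList k r D
  · cases x
    · rfl
    · exact absurd ⟨hqf, hx⟩ (hnot q)
  · cases x
    · exact absurd ⟨hx, hqt⟩ (hnot _)
    · simp

/-- From every quiet configuration, some round is not good. -/
theorem exists_bad_round (hP : P false ≠ P true) (hwf : I.WaitFree) (hD : Reachable P w D)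
    (hq : D.Quiet m) :
    ∃ l, (runList P w l D).Quiet m.succ ∧ ¬ GoodRound m l (runList P w l D) := by
  by_contra hcon
  push Not at hcon
  have hbi : Bivalent P w D m D := ⟨⟨[], rfl⟩, exists_mayWin_both hP hwf hD hq hcon⟩
  choose! g hg using fun c (hc : Bivalent P w D m c) => hc.exists_step hP hwf hD hq hcon
  -- Always choosing a turn that preserves bivalence gives an infinite schedule along which no
  -- operation of the round is completed.
  let f : ℕ → Config I.Loc I.Val V := fun i => (fun c => step P w (g c) c)^[i] D
  have hf : ∀ i, f (i + 1) = step P w (g (f i)) (f i) := fun i =>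
    Function.iterate_succ_apply' _ _ _
  have hfb : ∀ i, Bivalent P w D m (f i) := by
    intro i
    induction i with
    | zero => exact hbi
    | succ i ih => exact hf i ▸ hg _ ih
  obtain ⟨σ, N, hN, hσ⟩ := hD.splice fun i => g (f i)
  have hconf : ∀ i, config I P w σ (N + i) = f i := by
    intro i
    induction i with
    | zero => exact hN
    | succ i ih => rw [← add_assoc, config, ih, hσ, hf]
  have hm : ∀ i q, 2 * m ≤ ((f i).ps q).prog := by
    intro i q
    obtain ⟨⟨k, hk⟩, -⟩ := hfb i
    rw [hk, ← hq q]
    exact prog_le_runList k q D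
  have hinf : ∃ p, ∀ M, ∃ i, M ≤ i ∧ g (f i) = p := by
    by_contra hno
    push Not at hno
    obtain ⟨M, hM⟩ := hno false
    obtain ⟨M', hM'⟩ := hno true
    have h1 := hM (max M M') (le_max_left _ _)
    have h2 := hM' (max M M') (le_max_right _ _)
    cases hgf : g (f (max M M')) <;> simp_all
  obtain ⟨p, hp⟩ := hinf
  refine no_starvation (w := w) hP hwf (σ := σ) (p := p) (N := N) (m := m) (fun i hi => ?_)
    (fun M => ?_)
  · obtain ⟨j, rfl⟩ := Nat.exists_eq_add_of_le hi
    have h1 := hm j p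
    have h2 := (hfb j).prog_le hcon p
    rw [hconf]
    omega
  · obtain ⟨i, hi, hgi⟩ := hp M
    refine ⟨N + i, by omega, by rw [hσ, hgi], ?_⟩
    rw [hconf]
    exact not_skips ((hfb i).prog_le hcon p) (hm i _)

end Valency

end TwoProcess

/-! ### Fetch-and-cons rounds in a linearization -/

namespace History

/-- If two processes perform fetch-and-cons operations in rounds, and the history is
`t`-linearizable, then the answers are eventually those of a linearizable object. -/
theorem TLinearizable.exists_good_round {n : ℕ} {W : Type} [Primcodable W]
    {H : History n (DataType.fetchAndCons W)} {t : ℕ} (ht : H.TLinearizable t)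
    {A B : Bool → ℕ → ℕ} {Y : Bool → ℕ → List W} (hret : ∀ p m, H.Returns (A p m) (B p m) (Y p m))
    (hinv : ∀ i q x, H i = some (.inv q x) → ∃ p m, i = A p m)
    (hround : ∀ p q m, B p m < A q (m + 1)) (hne : ∀ m, A false m ≠ A true m) :
    ∃ m, (∀ p, (Y p m).length = 2 * m ∨ (Y p m).length = 2 * m + 1) ∧
      (Y false m).length ≠ (Y true m).length ∧
      ∀ p, B p m < A (!p) m → (Y p m).length < (Y (!p) m).length := by
  obtain ⟨S, ⟨hocc, st, hst0, hst⟩, hcomplete, horder, hresp⟩ := ht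
  have hAB : ∀ p m, A p m < B p m := fun p m => (hret p m).lt
  have hAmono : ∀ p q m m', m < m' → B p m < A q m' := by
    intro p q m m' h
    induction m', h using Nat.le_induction with
    | base => exact hround p q m
    | succ m' _ ih => exact ih.trans ((hAB q m').trans (hround q q m'))
  have hAinj : ∀ p q m m', A p m = A q m' → p = q ∧ m = m' := by
    intro p q m m' h
    rcases lt_trichotomy m m' with h' | rfl | h'
    · have := hAmono p q m m' h'
      have := hAB p m
      omega
    · have := hne m
      refine ⟨?_, rfl⟩
      cases p <;> cases q <;> first | rfl | omega
    · have := hAmono q p m' m h'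
      have := hAB q m'
      omega
  have hinvA : ∀ p m, ∃ q x, H (A p m) = some (.inv q x) := by
    intro p m
    obtain ⟨q, x, h, -⟩ := hret p m
    exact ⟨q, x, h⟩
  have hsufA : ∀ p m, m ≤ Nat.count (fun k => (H k).isSome = true) (A p m) := by
    intro p m
    induction m with
    | zero => exact Nat.zero_le _
    | succ m ih =>
      have h1 : A p m + 1 ≤ A p (m + 1) := by
        have := hAB p m
        have := hround p p m
        omega
      have h2 := Nat.count_monotone (fun k => (H k).isSome = true) h1
      obtain ⟨q, x, h3⟩ := hinvA p m
      rw [Nat.count_succ, if_pos (by simp [h3])] at h2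
      omega
  -- Every earlier round contributes at least one event, so rounds from `t` on lie beyond the first
  -- `t` events.
  have hsufA' : ∀ p m, t ≤ m → H.InSuffix t (A p m) := fun p m h => h.trans (hsufA p m)
  have hsufB : ∀ p m, t ≤ m → H.InSuffix t (B p m) := fun p m h =>
    (hsufA' p m h).trans (Nat.count_monotone _ (hAB p m).le)
  choose pos z hpos using fun p m => hcomplete _ _ _ (hret p m)
  have hposeq : ∀ {p m k y}, S k = some (A p m, y) → k = pos p m := fun h =>
    hocc _ _ _ _ _ h (hpos _ _)
  have hposinj : ∀ {p q m m'}, pos p m = pos q m' → p = q ∧ m = m' := by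
    intro p q m m' h
    have h1 := hpos p m
    rw [h, hpos q m'] at h1
    have h2 := (Prod.ext_iff.1 (Option.some.inj h1)).1
    exact hAinj _ _ _ _ h2.symm
  have hlt : ∀ {p q m m'}, t ≤ m → t ≤ m' → B p m < A q m' → pos p m < pos q m' := by
    intro p q m m' hm hm' h
    obtain ⟨k, y, hk, hlt⟩ := horder _ _ _ _ (hret p m) h (hsufB p m hm) (hsufA' q m' hm') _ _
      (hpos q m')
    rwa [hposeq hk] at hlt
  -- The order condition says nothing about rounds before `t`, whose operations may stand anywhere.
  -- They are finitely many, though, so a late round `m` stands after all of them.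
  obtain ⟨K, hK⟩ : ∃ K, ∀ p, ∀ m < t, pos p m < K := by
    refine ⟨(Finset.range t).sup (fun m => max (pos false m) (pos true m)) + 1, fun p m hm => ?_⟩
    have h1 : max (pos false m) (pos true m) ≤ _ :=
      Finset.le_sup (f := fun m => max (pos false m) (pos true m)) (Finset.mem_range.2 hm)
    cases p <;> omega
  obtain ⟨m, hmt, hmK⟩ : ∃ m, t ≤ m ∧ ∀ p, K ≤ pos p m := by
    have hinj : ∀ p, Function.Injective (pos p) := fun p a b h => (hposinj h).2
    have h1 := (hinj false).nat_tendsto_atTop.eventually_ge_atTop K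
    have h2 := (hinj true).nat_tendsto_atTop.eventually_ge_atTop K
    obtain ⟨m, ⟨hf, ht⟩, hm⟩ := ((h1.and h2).and (Filter.eventually_ge_atTop t)).exists
    exact ⟨m, hm, fun p => by cases p <;> assumption⟩
  have hbefore : ∀ p q r, r < m → pos q r < pos p m := by
    intro p q r hr
    by_cases hrt : t ≤ r
    · exact hlt hrt hmt (hAmono q p r m hr)
    · exact (hK q r (by omega)).trans_le (hmK p)
  have hafter : ∀ p q r, m < r → pos p m < pos q r := fun p q r hr =>
    hlt hmt (by omega) (hAmono p q m r hr)
  let len : ℕ → ℕ := fun k => List.length (α := W) (st k)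
  have hlen_none : ∀ k, S k = none → len (k + 1) = len k := by
    intro k hk
    have := hst k
    rw [hk] at this
    exact congrArg (List.length (α := W)) this
  have hlen_some : ∀ k i y, S k = some (i, y) →
      len (k + 1) = len k + 1 ∧ len k = List.length (α := W) y := by
    intro k i y hk
    have := hst k
    rw [hk] at this
    obtain ⟨q, x, -, hδ⟩ := this
    have h1 := Prod.ext_iff.1 hδ
    exact ⟨(congrArg (List.length (α := W)) h1.2).symm, congrArg (List.length (α := W)) h1.1⟩
  -- The length of the list counts the occupied positions before `k`; gaps do not contribute.
  have hcount : ∀ k, len k = ((Finset.range k).filter fun k' => S k' ≠ none).card := by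
    intro k
    induction k with
    | zero =>
      have : st 0 = ([] : List W) := hst0
      simp [len, this]
    | succ k ih =>
      rw [Finset.range_add_one, Finset.filter_insert]
      split
      · rename_i h
        obtain ⟨⟨i, y⟩, hy⟩ := Option.ne_none_iff_exists'.1 h
        rw [Finset.card_insert_of_notMem (by simp), (hlen_some k i y hy).1, ih]
      · rename_i h
        rw [hlen_none k (by simpa using h), ih]
  have hlenmono : ∀ {k k'}, k < k' → S k ≠ none → len k < len k' := by
    intro k k' h hk
    rw [hcount, hcount]
    refine Finset.card_lt_card ⟨fun x hx => ?_, fun hsub => ?_⟩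
    · simp only [Finset.mem_filter, Finset.mem_range] at hx ⊢
      exact ⟨hx.1.trans h, hx.2⟩
    · have := hsub (Finset.mem_filter.2 ⟨Finset.mem_range.2 h, hk⟩)
      simp at this
  have hY : ∀ p, (Y p m).length = len (pos p m) := by
    intro p
    obtain ⟨k, hk⟩ := hresp _ _ _ (hret p m) (hsufB p m hmt)
    rw [← hposeq hk]
    exact (hlen_some _ _ _ hk).2.symm
  have hposne : ∀ p r, S (pos p r) ≠ none := fun p r => by rw [hpos]; simp
  have hinjOn : ∀ s : Finset (Bool × ℕ), Set.InjOn (fun o : Bool × ℕ => pos o.1 o.2) s := by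
    rintro s ⟨p, r⟩ - ⟨q, r'⟩ - h
    obtain ⟨rfl, rfl⟩ := hposinj h
    rfl
  refine ⟨m, fun p => ?_, ?_, fun p h => ?_⟩
  · rw [hY, hcount]
    -- All `2 * m` operations of earlier rounds precede those of round `m`.
    have hlow : (Finset.univ ×ˢ Finset.range m).image (fun o : Bool × ℕ => pos o.1 o.2) ⊆
        (Finset.range (pos p m)).filter fun k' => S k' ≠ none := by
      intro k hk
      simp only [Finset.mem_image, Finset.mem_product, Finset.mem_univ, true_and,
        Finset.mem_range, Prod.exists] at hk
      obtain ⟨q, r, hr, rfl⟩ := hk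
      exact Finset.mem_filter.2 ⟨Finset.mem_range.2 (hbefore p q r hr), hposne q r⟩
    -- Only operations of rounds up to `m`, other than the operation itself, can precede it: at most
    -- `2 * m + 1`. Pending operations that `S` might complete do not arise, because `hinv` accounts
    -- for all invocations.
    have hup : ((Finset.range (pos p m)).filter fun k' => S k' ≠ none) ⊆
        ((Finset.univ ×ˢ Finset.range (m + 1)).erase (p, m)).image
          (fun o : Bool × ℕ => pos o.1 o.2) := by
      intro k hk
      obtain ⟨hk1, hk2⟩ := Finset.mem_filter.1 hk
      obtain ⟨⟨i, y⟩, hy⟩ := Option.ne_none_iff_exists'.1 hk2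
      have := hst k
      rw [hy] at this
      obtain ⟨q, x, hq, -⟩ := this
      obtain ⟨q', r, rfl⟩ := hinv _ _ _ hq
      have hkpos := hposeq hy
      have hk1 := Finset.mem_range.1 hk1
      refine Finset.mem_image.2 ⟨(q', r), Finset.mem_erase.2 ⟨?_, ?_⟩, hkpos.symm⟩
      · intro h
        obtain ⟨rfl, rfl⟩ := Prod.ext_iff.1 h
        simp [hkpos] at hk1
      · simp only [Finset.mem_product, Finset.mem_univ, Finset.mem_range, true_and]
        by_contra hr
        have := hafter p q' r (by omega)
        omega
    have h1 := Finset.card_le_card hlow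
    have h2 := Finset.card_le_card hup
    rw [Finset.card_image_of_injOn (hinjOn _)] at h1 h2
    rw [Finset.card_erase_of_mem (by simp)] at h2
    simp only [Finset.card_product, Finset.card_univ, Fintype.card_bool, Finset.card_range] at h1 h2
    omega
  · rw [hY, hY]
    have : pos false m ≠ pos true m := fun h => by simpa using (hposinj h).1
    rcases this.lt_or_gt with h | h
    · exact (hlenmono h (hposne _ _)).ne
    · exact (hlenmono h (hposne _ _)).ne'
  · rw [hY, hY]
    exact hlenmono (hlt hmt hmt h) (hposne _ _)

end History

/-- Infinitely many nonempty finite schedules can be concatenated. -/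
theorem exists_concatenation (l : ℕ → List Bool) (hl : ∀ m, l m ≠ []) :
    ∃ (σ : ℕ → Bool) (T : ℕ → ℕ), T 0 = 0 ∧ ∀ m, T (m + 1) = T m + (l m).length ∧
      ∀ j (hj : j < (l m).length), σ (T m + j) = (l m)[j] := by
  let L : ℕ → List Bool := fun m => Nat.rec [] (fun i r => r ++ l i) m
  have hL : ∀ m, L (m + 1) = L m ++ l m := fun m => rfl
  have hlen : ∀ m, m ≤ (L m).length := by
    intro m
    induction m with
    | zero => exact Nat.zero_le _
    | succ m ih =>
      have := List.length_pos_iff.2 (hl m)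
      rw [hL, List.length_append]
      omega
  have hstable : ∀ a b i, a ≤ b → i < (L a).length → (L b).getD i false = (L a).getD i false := by
    intro a b i hab hi
    have hpre : L a <+: L b := by
      induction b, hab using Nat.le_induction with
      | base => exact List.prefix_rfl
      | succ b _ ih => exact ih.trans (hL b ▸ List.prefix_append _ _)
    obtain ⟨r, hr⟩ := hpre
    rw [← hr, List.getD_append _ _ _ _ hi]
  -- Nonempty pieces give `L (i + 1)` length at least `i + 1`, so its entry at `i` is genuine and
  -- the default `false` plays no role.
  refine ⟨fun i => (L (i + 1)).getD i false, fun m => (L m).length, rfl, fun m => ⟨?_, ?_⟩⟩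
  · simp [hL]
  · intro j hj
    have h1 : (L (m + 1)).getD ((L m).length + j) false = (l m)[j] := by
      rw [hL, List.getD_append_right _ _ _ _ (by omega), Nat.add_sub_cancel_left,
        List.getD_eq_getElem _ _ hj]
    rw [← h1]
    show (L ((L m).length + j + 1)).getD ((L m).length + j) false = _
    have h2 : (L m).length + j < (L (m + 1)).length := by simp [hL, hj]
    have h3 := hlen ((L m).length + j + 1)
    rcases le_total (m + 1) ((L m).length + j + 1) with h | h
    · exact hstable _ _ _ h h2
    · exact (hstable _ _ _ h (by omega)).symm

/-! ### The run in which every round is bad -/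

namespace TwoProcess

variable {n : ℕ} {V W : Type} [Primcodable V] [Primcodable W]
variable {I : Implementation n (DataType.fetchAndCons W) (DataType.consensus V)}
  {P : Bool → Fin n} {w : W}

/-- A bad round ends in a quiet configuration, from which the next bad round is chosen. Each piece
of the schedule is nonempty because `prog` must grow during a round. -/
theorem exists_bad_run (hP : P false ≠ P true) (hwf : I.WaitFree) :
    ∃ (σ : ℕ → Bool) (T : ℕ → ℕ) (l : ℕ → List Bool), T 0 = 0 ∧
      (∀ m, T (m + 1) = T m + (l m).length) ∧
      (∀ m j (hj : j < (l m).length), σ (T m + j) = (l m)[j]) ∧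
      ∀ m, (config I P w σ (T m)).Quiet m ∧ ¬ GoodRound m (l m) (config I P w σ (T (m + 1))) := by
  have hbad : ∀ (D : Config I.Loc I.Val V) m, Reachable P w D ∧ D.Quiet m →
      ∃ l, (runList P w l D).Quiet m.succ ∧ ¬ GoodRound m l (runList P w l D) := fun D m h =>
    exists_bad_round hP hwf h.1 h.2
  choose! g hg using hbad
  let D : ℕ → Config I.Loc I.Val V :=
    fun m => Nat.rec (initial I P) (fun i c => runList P w (g c i) c) m
  have hD : ∀ m, D (m + 1) = runList P w (g (D m) m) (D m) := fun m => rfl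
  have hDm : ∀ m, Reachable P w (D m) ∧ (D m).Quiet m := by
    intro m
    induction m with
    | zero => exact ⟨⟨fun _ => false, 0, rfl⟩, fun p => rfl⟩
    | succ m ih => exact ⟨hD m ▸ ih.1.runList _, hD m ▸ (hg _ _ ih).1⟩
  have hne : ∀ m, g (D m) m ≠ [] := by
    intro m h
    have h1 := (hDm (m + 1)).2 false
    have h2 := (hDm m).2 false
    rw [hD, h, runList_nil] at h1
    omega
  obtain ⟨σ, T, hT0, hT⟩ := exists_concatenation _ hne
  have hconf : ∀ m, config I P w σ (T m) = D m := by
    intro m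
    induction m with
    | zero => rw [hT0]; rfl
    | succ m ih => rw [(hT m).1, config_add_length (hT m).2, ih, hD]
  refine ⟨σ, T, _, hT0, fun m => (hT m).1, fun m => (hT m).2, fun m => ⟨?_, ?_⟩⟩
  · rw [hconf]
    exact (hDm m).2
  · rw [hconf, hD]
    exact (hg _ _ (hDm m)).2

theorem exists_ret {σ : ℕ → Bool} {p : Bool} {N N' : ℕ} (hN : N ≤ N')
    (h : ((config I P w σ N').ps p).prog % 2 = 0)
    (hlt : ((config I P w σ N).ps p).prog < ((config I P w σ N').ps p).prog) :
    ∃ b, N ≤ b ∧ b < N' ∧ σ b = p ∧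
      ((config I P w σ b).ps p).prog + 1 = ((config I P w σ N').ps p).prog ∧
      ∃ y : List W, ((config I P w σ N').ps p).last = y.length ∧
        firstEvent P w p (config I P w σ b) = some (.ret (P p) y) := by
  induction N', hN using Nat.le_induction with
  | base => omega
  | succ N' hN ih =>
    have hsucc : config I P w σ (N' + 1) = step P w (σ N') (config I P w σ N') := rfl
    by_cases heq : ((config I P w σ (N' + 1)).ps p).prog = ((config I P w σ N').ps p).prog
    · have hlast : ((config I P w σ (N' + 1)).ps p).last = ((config I P w σ N').ps p).last :=
        last_step heq
      rw [heq] at h hlt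
      obtain ⟨b, h1, h2, h3⟩ := ih h hlt
      rw [heq, hlast]
      exact ⟨b, h1, by omega, h3⟩
    · have hp : σ N' = p := by
        by_contra hne
        rw [hsucc, step_ps_of_ne (Ne.symm hne)] at heq
        exact heq rfl
      rw [hsucc, hp] at h heq ⊢
      rcases step_progress (P := P) (w := w) p (config I P w σ N') with h' | h' | h'
      · omega
      · omega
      · obtain ⟨-, h1, h2⟩ := h'
        exact ⟨N', hN, by omega, hp, h1.symm, h2⟩

theorem history_even_of_invoke {σ : ℕ → Bool} {a : ℕ} {q : Fin n} {x : W}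
    (h : firstEvent P w (σ a) (config I P w σ a) = some (.invoke q x)) :
    I.history (run I P w σ) (2 * a) = some (.inv q x) := by
  simp only [Implementation.history, run_even, h]

theorem history_even_of_ret {σ : ℕ → Bool} {a : ℕ} {q : Fin n} {y : List W}
    (h : firstEvent P w (σ a) (config I P w σ a) = some (.ret q y)) :
    I.history (run I P w σ) (2 * a) = some (.res q y) := by
  simp only [Implementation.history, run_even, h]

/-- An event of the implemented object makes its process progress. -/
theorem exists_of_history {σ : ℕ → Bool} {i : ℕ} {ev : ObjEvent n (DataType.fetchAndCons W)}
    (h : I.history (run I P w σ) i = some ev) : ∃ a, i = 2 * a ∧ ev.proc = P (σ a) ∧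
      ((config I P w σ (a + 1)).ps (σ a)).prog = ((config I P w σ a).ps (σ a)).prog + 1 ∧
      (∀ q x, ev = .inv q x → ((config I P w σ a).ps (σ a)).prog % 2 = 0) := by
  obtain ⟨a, rfl | rfl⟩ := Nat.even_or_odd' i
  · refine ⟨a, rfl, ?_⟩
    simp only [Implementation.history, run_even] at h
    rcases step_progress (P := P) (w := w) (σ a) (config I P w σ a) with
      ⟨-, -, h1, h2⟩ | ⟨h1, h2, -, h3⟩ | ⟨h1, h2, y, -, h3⟩
    · split at h
      · exact absurd ‹_› (h1 _ _)
      · exact absurd ‹_› (h2 _ _)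
      · cases h
    · rw [h3] at h
      cases h
      exact ⟨rfl, h2, fun _ _ _ => h1⟩
    · rw [h3] at h
      cases h
      exact ⟨rfl, h2, fun _ _ h => by cases h⟩
  · simp only [Implementation.history, run_odd] at h
    split at h
    · exact absurd ‹_› (secondEvent_ne_invoke _ _ _ _)
    · exact absurd ‹_› (secondEvent_ne_ret _ _ _ _)
    · cases h

/-- In every round, every process performs an operation. -/
theorem exists_round_op (hP : P false ≠ P true) {σ : ℕ → Bool} {N N' m : ℕ} (hN : N ≤ N')
    (hq : (config I P w σ N).Quiet m) (hq' : (config I P w σ N').Quiet (m + 1)) (p : Bool) :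
    ∃ a b, ∃ y : List W, N ≤ a ∧ a < b ∧ b < N' ∧ σ a = p ∧ σ b = p ∧
      ((config I P w σ a).ps p).prog = 2 * m ∧ ((config I P w σ (a + 1)).ps p).prog = 2 * m + 1 ∧
      ((config I P w σ N').ps p).last = y.length ∧
      (I.history (run I P w σ)).Returns (2 * a) (2 * b) y := by
  have hinj : ∀ q, P q = P p → q = p := by
    intro q h
    cases p <;> cases q <;> simp_all
  have hqN := hq p
  have hqN' := hq' p
  obtain ⟨b, hNb, hbN, hpb, hprog, y, hy, hb⟩ :=
    exists_ret (I := I) (P := P) (w := w) (σ := σ) hN (p := p) (by omega) (by omega)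
  obtain ⟨a, hab, hpa, hlt, ha, hbetween⟩ :=
    exists_invoke (I := I) (P := P) (w := w) (σ := σ) (p := p) (N := b) (by omega)
  -- An invocation before `N` would leave the process inside its operation at `N`, where it is idle.
  have hNa : N ≤ a := by
    by_contra hcon
    have := hbetween N (by omega) hNb
    omega
  have hmono : ((config I P w σ N).ps p).prog ≤ ((config I P w σ a).ps p).prog :=
    prog_mono σ p hNa
  have hnext := hbetween (a + 1) (by omega) hab
  refine ⟨a, b, y, hNa, hab, hbN, hpa, hpb, by omega, by omega, hy, P p, w,
    history_even_of_invoke (hpa ▸ ha), by omega, history_even_of_ret (hpb ▸ hb), ?_⟩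
  intro k h1 h2 ev hev hproc
  obtain ⟨i, rfl, hproc', hstep, -⟩ := exists_of_history hev
  rw [hproc] at hproc'
  rw [hinj _ hproc'.symm] at hstep
  have e1 := hbetween i (by omega) (by omega)
  have e2 := hbetween (i + 1) (by omega) (by omega)
  omega

/-- In the run of `exists_bad_run` every round is bad, but a `t`-linearization, whatever `t` is,
would make some round good. -/
theorem not_eventuallyLinearizable (hP : P false ≠ P true) (w : W) (hwf : I.WaitFree) :
    ¬ I.EventuallyLinearizable := by
  intro hel
  obtain ⟨σ, T, l, hT0, hT, hσ, hbad⟩ := exists_bad_run (w := w) hP hwf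
  obtain ⟨-, t, ht⟩ := hel _ (isExecution_run (w := w) hP σ)
  choose A B Y hTA hAB hBT hσA hσB hprogA hprogA' hlast hret using fun p m =>
    exists_round_op hP (show T m ≤ T (m + 1) by rw [hT]; omega) (hbad m).1 (hbad (m + 1)).1 p
  have hinv : ∀ i q x, I.history (run I P w σ) i = some (.inv q x) → ∃ p m, i = 2 * A p m := by
    intro i q x hi
    obtain ⟨a, rfl, -, hstep, heven⟩ := exists_of_history hi
    have heven := heven _ _ rfl
    -- Half of `prog` is the number of the round. Since `prog` is monotone, it leaves the value `2 *
    -- m` only once, so the invocation is the chosen one.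
    refine ⟨σ a, ((config I P w σ a).ps (σ a)).prog / 2, ?_⟩
    generalize hm : ((config I P w σ a).ps (σ a)).prog / 2 = m
    have e1 := hprogA (σ a) m
    have e2 := hprogA' (σ a) m
    rcases lt_trichotomy a (A (σ a) m) with h | h | h
    · have := prog_mono (I := I) (P := P) (w := w) σ (σ a) (Nat.succ_le_of_lt h)
      simp only [Nat.succ_eq_add_one] at this
      omega
    · rw [← h]
    · have := prog_mono (I := I) (P := P) (w := w) σ (σ a) (Nat.succ_le_of_lt h)
      simp only [Nat.succ_eq_add_one] at this
      omega
  obtain ⟨m, hval, hne, hseq⟩ := ht.exists_good_round (A := fun p m => 2 * A p m)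
    (B := fun p m => 2 * B p m) (Y := Y) hret hinv
    (fun p q m => by
      have := hBT p m
      have := hTA q (m + 1)
      omega)
    (fun m h => by
      have h' : A false m = A true m := by simpa using h
      have h1 := hσA false m
      rw [h', hσA true m] at h1
      cases h1)
  refine (hbad m).2 ⟨fun p => hlast p m ▸ hval p, by rw [hlast, hlast]; exact hne, ?_⟩
  rintro p ⟨a, b, hl⟩
  rw [hlast, hlast]
  refine hseq p ?_
  have hlen := hT m
  -- In a sequential round, `p` has all turns before `T m + a` and the other process all later ones,
  -- so the two operations do not overlap.
  have hget : ∀ i, T m ≤ i → i < T (m + 1) → σ i = if i < T m + a then p else !p := by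
    intro i h1 h2
    obtain ⟨j, rfl⟩ := Nat.exists_eq_add_of_le h1
    rw [hσ m j (by omega)]
    simp only [hl, List.getElem_append, List.length_replicate, List.getElem_replicate,
      Nat.add_lt_add_iff_left]
    split <;> rfl
  have e1 := hget (B p m) (by have := hTA p m; have := hAB p m; omega) (hBT p m)
  have e2 := hget (A (!p) m) (hTA _ m) ((hAB _ m).trans (hBT _ m))
  rw [hσB] at e1
  rw [hσA] at e2
  have e3 : B p m < T m + a := by
    by_contra hcon
    rw [if_neg hcon] at e1
    simp at e1
  have e4 : T m + a ≤ A (!p) m := by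
    by_contra hcon
    rw [if_pos (by omega)] at e2
    simp at e2
  omega

end TwoProcess

/-- Processes 0 and 1 are the active ones; all others never take a step. -/
theorem not_eventuallyImplements_of_two_le {n : ℕ} (hn : 2 ≤ n) (V W : Type) [Primcodable V]
    [Primcodable W] [Nonempty W] :
    ¬ EventuallyImplements n (DataType.consensus V) (DataType.fetchAndCons W) := by
  rintro ⟨I, hwf, hel⟩
  obtain ⟨w⟩ := ‹Nonempty W›
  refine TwoProcess.not_eventuallyLinearizable (P := fun b => if b then ⟨1, by omega⟩ else ⟨0, by omega⟩)
    ?_ w hwf hel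
  simp

/-! ## Registers to which only one value is written -/

namespace History

variable {n : ℕ} {A : Type} [Primcodable A] {a₀ u : A}
  {H : History n (DataType.register A a₀)}

/-- Along a linearization the state is `a₀` up to the first write and `u` from then on. The clauses
concern the values of reads, the acknowledgement of writes, reads after a completed write, and the
common value of all late reads. -/
theorem Linearizable.writeOnce (hH : H.Linearizable)
    (hu : ∀ (i : ℕ) (q : Fin n) (a : A), H i = some (.inv q (some a)) → a = u) :
    (∀ (i j : ℕ) (q : Fin n) (y : Option A), H.Returns i j y → H i = some (.inv q none) →
      y = some a₀ ∨ (y = some u ∧ ∃ i' < j, ∃ q' : Fin n, H i' = some (.inv q' (some u)))) ∧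
    (∀ (i j : ℕ) (q : Fin n) (a : A) (y : Option A), H.Returns i j y →
      H i = some (.inv q (some a)) → y = none) ∧
    (∀ (i j i' j' : ℕ) (q q' : Fin n) (a : A) (y y' : Option A), H.Returns i j y →
      H i = some (.inv q (some a)) → H.Returns i' j' y' → H i' = some (.inv q' none) → j < i' →
      y' = some u) ∧
    ∃ (b : A) (M : ℕ), ∀ (i j : ℕ) (q : Fin n) (y : Option A), H.Returns i j y →
      H i = some (.inv q none) → M ≤ i → y = some b := by
  obtain ⟨S, ⟨hocc, st, hst0, hst⟩, hcomplete, horder, hresp⟩ := hH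
  have hst0 : st 0 = a₀ := hst0
  have hinv : ∀ {i j : ℕ} {y : Option A}, H.Returns i j y → ∃ k, S k = some (i, y) :=
    fun h => hresp _ _ _ h (Nat.zero_le _)
  have hread : ∀ {k i : ℕ} {q : Fin n} {y : Option A}, S k = some (i, y) →
      H i = some (.inv q none) → y = some (st k) ∧ st (k + 1) = st k := by
    intro k i q y hk hi
    have := hst k
    rw [hk] at this
    obtain ⟨q', x, h1, h2⟩ := this
    rw [hi] at h1
    obtain ⟨-, rfl⟩ := ObjEvent.inv.inj (Option.some.inj h1)
    have := Prod.ext_iff.1 h2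
    exact ⟨this.1.symm, this.2.symm⟩
  have hwrite : ∀ {k i : ℕ} {q : Fin n} {a : A} {y : Option A}, S k = some (i, y) →
      H i = some (.inv q (some a)) → y = none ∧ st (k + 1) = u := by
    intro k i q a y hk hi
    have := hst k
    rw [hk] at this
    obtain ⟨q', x, h1, h2⟩ := this
    rw [hi] at h1
    obtain ⟨-, rfl⟩ := ObjEvent.inv.inj (Option.some.inj h1)
    have := Prod.ext_iff.1 h2
    exact ⟨this.1.symm, this.2.symm.trans (hu i q a hi)⟩
  have hcases : ∀ k, (S k = none ∧ st (k + 1) = st k) ∨ ∃ (i : ℕ) (y : Option A) (q : Fin n),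
      S k = some (i, y) ∧ (H i = some (.inv q none) ∨ H i = some (.inv q (some u))) := by
    intro k
    have := hst k
    rcases hk : S k with _ | ⟨i, y⟩
    · rw [hk] at this
      exact .inl ⟨rfl, this⟩
    · rw [hk] at this
      obtain ⟨q, x, h1, -⟩ := this
      refine .inr ⟨i, y, q, rfl, ?_⟩
      rcases x with _ | a
      · exact .inl h1
      · right
        rw [← hu i q a h1]
        exact h1
  have hbefore : ∀ k, st k = a₀ ∨ (st k = u ∧ ∃ k' < k, ∃ (i : ℕ) (y : Option A) (q : Fin n),
      S k' = some (i, y) ∧ H i = some (.inv q (some u))) := by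
    intro k
    induction k with
    | zero => exact .inl hst0
    | succ k ih =>
      rcases hcases k with ⟨-, h⟩ | ⟨i, y, q, hk, h | h⟩
      · rw [h]
        exact ih.imp_right fun ⟨h1, k', h2, h3⟩ => ⟨h1, k', by omega, h3⟩
      · rw [(hread hk h).2]
        exact ih.imp_right fun ⟨h1, k', h2, h3⟩ => ⟨h1, k', by omega, h3⟩
      · exact .inr ⟨(hwrite hk h).2, k, by omega, i, y, q, hk, h⟩
  have hafter : ∀ {k i : ℕ} {q : Fin n} {a : A} {y : Option A}, S k = some (i, y) →
      H i = some (.inv q (some a)) → ∀ k', k < k' → st k' = u := by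
    intro k i q a y hk hi k' hk'
    induction k', hk' using Nat.le_induction with
    | base => exact (hwrite hk hi).2
    | succ k' _ ih =>
      rcases hcases k' with ⟨-, h⟩ | ⟨i, y, q, hk, h | h⟩
      · rw [h, ih]
      · rw [(hread hk h).2, ih]
      · exact (hwrite hk h).2
  refine ⟨?_, ?_, ?_, ?_⟩
  · intro i j q y hr hi
    obtain ⟨k, hk⟩ := hinv hr
    have hy := (hread hk hi).1
    rcases hbefore k with h | ⟨h, k', hk', i', y', q', hS, hi'⟩
    · exact .inl (hy.trans (congrArg some h))
    · refine .inr ⟨hy.trans (congrArg some h), i', ?_, q', hi'⟩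
      -- Had the write been invoked after the read returned, it would stand after the read in `S`,
      -- and the read could not have seen it.
      by_contra hcon
      obtain ⟨p, x, -, -, hj, -⟩ := id hr
      have hne : j ≠ i' := by
        rintro rfl
        rw [hi'] at hj
        cases hj
      obtain ⟨k₁, y₁, hk₁, hlt⟩ := horder i j y i' hr (by omega) (Nat.zero_le _) (Nat.zero_le _)
        k' y' hS
      have := hocc _ _ _ _ _ hk hk₁
      omega
  · intro i j q a y hr hi
    obtain ⟨k, hk⟩ := hinv hr
    exact (hwrite hk hi).1
  · intro i j i' j' q q' a y y' hr hi hr' hi' hlt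
    obtain ⟨k', hk'⟩ := hinv hr'
    obtain ⟨k, y₁, hk, hkk'⟩ := horder i j y i' hr hlt (Nat.zero_le _) (Nat.zero_le _) k' y' hk'
    exact (hread hk' hi').1.trans (congrArg some (hafter hk hi k' hkk'))
  -- The state is constant from some position `K` on, and only finitely many operations stand before
  -- `K`, so reads invoked after all of these see the final value.
  · obtain ⟨b, K, hK⟩ : ∃ (b : A) (K : ℕ), ∀ k, K ≤ k → st k = b := by
      by_cases h : ∃ (k i : ℕ) (y : Option A) (q : Fin n),
          S k = some (i, y) ∧ H i = some (.inv q (some u))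
      · obtain ⟨k, i, y, q, hk, hi⟩ := h
        exact ⟨u, k + 1, hafter hk hi⟩
      · refine ⟨a₀, 0, fun k _ => ?_⟩
        rcases hbefore k with h' | ⟨-, k', -, i, y, q, h1, h2⟩
        · exact h'
        · exact absurd ⟨k', i, y, q, h1, h2⟩ h
    obtain ⟨M, hM⟩ : ∃ M, ∀ k < K, ∀ (i : ℕ) (y : Option A), S k = some (i, y) → i < M := by
      clear hK
      induction K with
      | zero => exact ⟨0, fun k hk => by omega⟩
      | succ K ih =>
        obtain ⟨M, hM⟩ := ih
        rcases hS : S K with _ | ⟨i₀, y₀⟩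
        · refine ⟨M, fun k hk i y h => ?_⟩
          rcases Nat.lt_succ_iff_lt_or_eq.1 hk with h' | rfl
          · exact hM k h' i y h
          · rw [hS] at h
            cases h
        · refine ⟨max M (i₀ + 1), fun k hk i y h => ?_⟩
          rcases Nat.lt_succ_iff_lt_or_eq.1 hk with h' | rfl
          · have := hM k h' i y h
            omega
          · rw [hS] at h
            have := (Prod.ext_iff.1 (Option.some.inj h)).1
            simp only at this
            omega
    refine ⟨b, M, fun i j q y hr hi hMi => ?_⟩
    obtain ⟨k, hk⟩ := hinv hr
    refine (hread hk hi).1.trans (congrArg some (hK k ?_))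
    by_contra hcon
    have := hM k (by omega) i y hk
    omega

end History

/-! ## Consensus from registers -/

/-- Every process writes its first proposal into its own register, at the beginning of every
operation, and then reads the registers in a fixed order until it finds a value, which it returns.
The local state consists of the first proposal, the value found, and the number of accesses. -/
def registerConsensus (n : ℕ) (V : Type) [Primcodable V] :
    Implementation n (DataType.consensus V) DataType.noOperation where
  Val := Option V
  Loc := Option V × Option V × ℕ
  regInit := fun _ => none
  locInit := fun _ => (none, none, 0)
  onInvoke := fun _ s v => (some (s.1.getD v), none, 0)
  action := fun p s => Option.casesOn s.2.1
    -- Access 0 is the write and access `k + 1` reads register `k % n`. The remainder keeps the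
    -- index below `n` for every local state, reachable or not.
    (Nat.casesOn s.2.2 (.inr (.inr (p.val, some s.1))) fun k => .inr (.inr (k % n, none)))
    fun y => .inl y
  onObjReply := fun _ s _ => s
  -- The acknowledgement `none` of a write and the content `some none` of an unwritten register both
  -- count as nothing found.
  onRegReply := fun _ s y => (s.1, y.bind id, s.2.2 + 1)
  regInit_computable := Computable.const _
  onInvoke_computable := fun _ => by
    have h1 : Primrec₂ fun (s : Option V × Option V × ℕ) (v : V) => s.1.getD v :=
      Primrec.option_getD.comp (Primrec.fst.comp Primrec.fst) Primrec.snd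
    exact (Primrec.pair (Primrec.option_some.comp h1) (Primrec.const (none, 0))).to_comp
  action_computable := fun p => by
    have h1 : Primrec fun s : Option V × Option V × ℕ => (Sum.inr (Sum.inr (p.val, some s.1)) :
        V ⊕ ((ℕ × Empty) ⊕ (ℕ × Option (Option V)))) :=
      Primrec.sumInr.comp (Primrec.sumInr.comp
        (Primrec.pair (Primrec.const _) (Primrec.option_some.comp Primrec.fst)))
    have h2 : Primrec₂ fun (_ : Option V × Option V × ℕ) (k : ℕ) =>
        (Sum.inr (Sum.inr (k % n, none)) : V ⊕ ((ℕ × Empty) ⊕ (ℕ × Option (Option V)))) :=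
      Primrec.sumInr.comp (Primrec.sumInr.comp
        (Primrec.pair (Primrec.nat_mod.comp Primrec.snd (Primrec.const _)) (Primrec.const _)))
    have h3 : Primrec₂ fun (_ : Option V × Option V × ℕ) (y : V) =>
        (Sum.inl y : V ⊕ ((ℕ × Empty) ⊕ (ℕ × Option (Option V)))) :=
      Primrec.sumInl.comp Primrec.snd
    exact (Primrec.option_casesOn (Primrec.fst.comp Primrec.snd)
      (Primrec.nat_casesOn (Primrec.snd.comp Primrec.snd) h1 h2) h3).to_comp
  onObjReply_computable := fun _ => Computable.fst
  onRegReply_computable := fun _ => by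
    have h1 : Primrec fun (s : (Option V × Option V × ℕ) × Option (Option V)) => s.2.bind id :=
      Primrec.option_bind Primrec.snd Primrec.snd
    exact (Primrec.pair (Primrec.fst.comp Primrec.fst) (Primrec.pair h1
      (Primrec.succ.comp (Primrec.snd.comp (Primrec.snd.comp Primrec.fst))))).to_comp

/-! ### Traces of programs and register calls -/

namespace Implementation

variable {n : ℕ} {T O : DataType} {I : Implementation n T O} {e : I.Run}
  {c : ℕ → Fin n → Status × I.Loc}

theorem LocalStep.proc_eq {p : Fin n} {s s' : Status × I.Loc} {ev : SysEvent n T O I.Val}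
    (h : I.LocalStep p s ev s') : ev.proc = p := by
  cases h <;> rfl

variable (I e c) in
/-- The states `c` of the processes witness that the run `e` follows the programs. -/
structure Traces : Prop where
  zero : ∀ p, c 0 p = (.idle, I.locInit p)
  stay : ∀ i, e i = none → c (i + 1) = c i
  move : ∀ i ev, e i = some ev → I.Step (c i) ev (c (i + 1))

theorem Follows.exists_traces (h : I.Follows e) : ∃ c, I.Traces e c := by
  obtain ⟨c, h0, h⟩ := h
  refine ⟨c, h0, fun i hi => ?_, fun i ev hi => ?_⟩
  · have := h i
    rwa [hi] at this
  · have := h i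
    rwa [hi] at this

theorem Traces.local_cases (hc : I.Traces e c) (i : ℕ) (p : Fin n) :
    (c (i + 1) p = c i p ∧ ∀ ev, e i = some ev → ev.proc ≠ p) ∨
      ∃ ev, e i = some ev ∧ I.LocalStep p (c i p) ev (c (i + 1) p) := by
  rcases he : e i with _ | ev
  · exact .inl ⟨by rw [hc.stay i he], by simp⟩
  · obtain ⟨q, hq, hother⟩ := hc.move i ev he
    by_cases hpq : p = q
    · subst hpq
      exact .inr ⟨ev, rfl, hq⟩
    · refine .inl ⟨hother p hpq, fun ev' h' => ?_⟩
      cases h'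
      rw [hq.proc_eq]
      exact Ne.symm hpq

/-- A process that waits for a register has called it, and taken no step since. -/
theorem Traces.exists_callReg (hc : I.Traces e c) {t : ℕ} {p : Fin n} {r : ℕ} {s : I.Loc}
    (h : c t p = (.waitReg r, s)) : ∃ i < t, ∃ x, e i = some (.callReg p r x) ∧
      c i p = (.running, s) ∧ I.action p s = .inr (.inr (r, x)) ∧
      ∀ k, i < k → k < t → ∀ ev, e k = some ev → ev.proc ≠ p := by
  induction t with
  | zero =>
    rw [hc.zero] at h
    cases h
  | succ t ih =>
    rcases hc.local_cases t p with ⟨h1, h2⟩ | ⟨ev, hev, hstep⟩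
    · rw [h1] at h
      obtain ⟨i, hi, x, hx, hci, ha, hb⟩ := ih h
      refine ⟨i, by omega, x, hx, hci, ha, fun k h3 h4 ev hev => ?_⟩
      rcases Nat.lt_succ_iff_lt_or_eq.1 h4 with h5 | rfl
      · exact hb k h3 h5 ev hev
      · exact h2 ev hev
    · rw [h] at hstep
      generalize hs : c t p = s₀ at hstep
      cases hstep with
      | callReg s k x ha =>
        exact ⟨t, by omega, x, hev, hs, ha, fun k h1 h2 => by omega⟩

theorem regHistory_callReg {i r : ℕ} {p : Fin n} {x : Option I.Val}
    (h : e i = some (.callReg p r x)) : I.regHistory e r i = some (.inv p x) := by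
  simp [regHistory, h]

theorem regHistory_replyReg {i r : ℕ} {p : Fin n} {y : Option I.Val}
    (h : e i = some (.replyReg p r y)) : I.regHistory e r i = some (.res p y) := by
  simp [regHistory, h]

theorem of_regHistory_inv {i r : ℕ} {p : Fin n} {x : Option I.Val}
    (h : I.regHistory e r i = some (.inv p x)) : e i = some (.callReg p r x) := by
  unfold regHistory at h
  split at h
  · split at h
    · cases h
      simp_all
    · cases h
  · split at h <;> cases h
  · cases h

theorem proc_of_regHistory {i r : ℕ} {ev : ObjEvent n (DataType.register I.Val (I.regInit r))}
    (h : I.regHistory e r i = some ev) : ∃ ev', e i = some ev' ∧ ev'.proc = ev.proc := by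
  unfold regHistory at h
  split at h
  · split at h
    · cases h
      exact ⟨_, ‹_›, rfl⟩
    · cases h
  · split at h
    · cases h
      exact ⟨_, ‹_›, rfl⟩
    · cases h
  · cases h

theorem of_history_inv {i : ℕ} {p : Fin n} {x : T.Inv}
    (h : I.history e i = some (.inv p x)) : e i = some (.invoke p x) := by
  unfold history at h
  split at h
  · cases h
    assumption
  · cases h
  · cases h

theorem of_history_res {i : ℕ} {p : Fin n} {y : T.Res}
    (h : I.history e i = some (.res p y)) : e i = some (.ret p y) := by
  unfold history at h
  split at h
  · cases h
  · cases h
    assumption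
  · cases h

end Implementation

namespace registerConsensus

variable {n : ℕ} {V : Type} [Primcodable V]

abbrev Loc (V : Type) : Type := Option V × Option V × ℕ

theorem action_eq_inl {p : Fin n} {s : Loc V} {y : V}
    (h : (registerConsensus n V).action p s = .inl y) : s.2.1 = some y := by
  obtain ⟨w, x | x, k⟩ := s
  · cases k <;> cases h
  · cases h
    rfl

theorem action_eq_reg {p : Fin n} {s : Loc V} {r : ℕ} {x : Option (Option V)}
    (h : (registerConsensus n V).action p s = .inr (.inr (r, x))) :
    s.2.1 = none ∧ ((s.2.2 = 0 ∧ r = p ∧ x = some s.1) ∨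
      ∃ k, s.2.2 = k + 1 ∧ r = k % n ∧ x = none) := by
  obtain ⟨w, x | x, k⟩ := s
  · cases k with
    | zero =>
      cases h
      exact ⟨rfl, .inl ⟨rfl, rfl, rfl⟩⟩
    | succ k =>
      cases h
      exact ⟨rfl, .inr ⟨k, rfl, rfl, rfl⟩⟩
  · cases h

section Run

variable {e : (registerConsensus n V).Run} {c : ℕ → Fin n → Status × Loc V}

/-- The kinds of steps of a process. -/
inductive StepCase (e : (registerConsensus n V).Run) (i : ℕ) (p : Fin n) :
    Status × Loc V → Status × Loc V → Prop
  | none (s : Status × Loc V) (h : ∀ ev, e i = some ev → ev.proc ≠ p) : StepCase e i p s s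
  | invoke (s : Loc V) (v : V) (h : e i = some (.invoke p v)) :
      StepCase e i p (.idle, s) (.running, some (s.1.getD v), none, 0)
  | ret (s : Loc V) (y : V) (h : e i = some (.ret p y)) (hy : s.2.1 = some y) :
      StepCase e i p (.running, s) (.idle, s)
  | call (s : Loc V) (r : ℕ) (x : Option (Option V)) (h : e i = some (.callReg p r x))
      (hs : s.2.1 = .none ∧ ((s.2.2 = 0 ∧ r = p ∧ x = some s.1) ∨
        ∃ k, s.2.2 = k + 1 ∧ r = k % n ∧ x = .none)) : StepCase e i p (.running, s) (.waitReg r, s)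
  | reply (s : Loc V) (r : ℕ) (y : Option (Option V)) (h : e i = some (.replyReg p r y)) :
      StepCase e i p (.waitReg r, s) (.running, s.1, y.bind id, s.2.2 + 1)

theorem StepCase.of_localStep {i : ℕ} {p : Fin n} {s s' : Status × (registerConsensus n V).Loc}
    {ev : SysEvent n (DataType.consensus V) DataType.noOperation (registerConsensus n V).Val}
    (hev : e i = some ev) (h : (registerConsensus n V).LocalStep p s ev s') :
    StepCase e i p s s' := by
  cases h with
  | invoke s x => exact .invoke s x hev
  | ret s y ha => exact .ret s y hev (action_eq_inl ha)
  | callObj s k x ha => exact x.elim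
  | replyObj s k y => exact y.elim
  | callReg s k x ha => exact .call s k x hev (action_eq_reg ha)
  | replyReg s k y => exact .reply s k y hev

theorem stepCase (hc : (registerConsensus n V).Traces e c) (i : ℕ) (p : Fin n) :
    StepCase e i p (c i p) (c (i + 1) p) := by
  rcases hc.local_cases i p with ⟨h1, h2⟩ | ⟨ev, hev, hstep⟩
  · rw [h1]
    exact .none _ h2
  · exact .of_localStep hev hstep

end Run

end registerConsensus

/-! ### Correctness of the register algorithm -/

namespace registerConsensus

variable {n : ℕ} {V : Type} [Primcodable V] {e : (registerConsensus n V).Run}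
  {c : ℕ → Fin n → Status × Loc V}

variable (e) in
/-- The first proposal of process `p` is `v`, invoked at instant `i`. -/
def First (p : Fin n) (v : V) (i : ℕ) : Prop :=
  e i = some (.invoke p v) ∧ ∀ j < i, ∀ x : V, e j ≠ some (.invoke p x)

/-- The first component of the local state is the first proposal. -/
theorem first_of_loc (hc : (registerConsensus n V).Traces e c) (t : ℕ) (p : Fin n) :
    ((c t p).2.1 = none → (c t p).1 = .idle ∧ ∀ j < t, ∀ x : V, e j ≠ some (.invoke p x)) ∧
    ∀ v, (c t p).2.1 = some v → ∃ i < t, First e p v i := by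
  induction t with
  | zero =>
    have h : c 0 p = (.idle, none, none, 0) := hc.zero p
    rw [h]
    exact ⟨fun _ => ⟨rfl, fun j hj => by omega⟩, fun v hv => by cases hv⟩
  | succ t ih =>
    have hstep := stepCase hc t p
    generalize c t p = s at *
    generalize c (t + 1) p = s' at *
    obtain ⟨ih1, ih2⟩ := ih
    have later : ∀ v, s.2.1 = some v → ∃ i < t + 1, First e p v i := fun v hv => by
      obtain ⟨i, hi, h⟩ := ih2 v hv
      exact ⟨i, by omega, h⟩
    cases hstep with
    | none _ h =>
      refine ⟨fun hn => ⟨(ih1 hn).1, fun j hj x hx => ?_⟩, later⟩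
      rcases Nat.lt_succ_iff_lt_or_eq.1 hj with h' | rfl
      · exact (ih1 hn).2 j h' x hx
      · exact h _ hx rfl
    | invoke s v h =>
      refine ⟨fun hn => (by cases hn), fun v' hv' => ?_⟩
      rcases hs : s.1 with _ | u
      · simp only [hs, Option.getD_none, Option.some.injEq] at hv'
        subst hv'
        exact ⟨t, by omega, h, (ih1 hs).2⟩
      · simp only [hs, Option.getD_some, Option.some.injEq] at hv'
        subst hv'
        exact later _ hs
    | ret s y h hy => exact ⟨fun hn => (by cases (ih1 hn).1), later⟩
    | call s r x h hs => exact ⟨fun hn => (by cases (ih1 hn).1), later⟩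
    | reply s r y h => exact ⟨fun hn => (by cases (ih1 hn).1), later⟩

theorem First.unique {p : Fin n} {v v' : V} {i i' : ℕ} (h : First e p v i)
    (h' : First e p v' i') : v = v' := by
  rcases lt_trichotomy i i' with hlt | rfl | hlt
  · exact absurd h.1 (h'.2 i hlt v)
  · have := h.1.symm.trans h'.1
    cases this
    rfl
  · exact absurd h'.1 (h.2 i' hlt v')

theorem call_cases (hc : (registerConsensus n V).Traces e c) {i r : ℕ} {p : Fin n}
    {x : Option (Option V)} (h : e i = some (.callReg p r x)) :
    ∃ s : Loc V, c i p = (.running, s) ∧ s.2.1 = none ∧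
      ((s.2.2 = 0 ∧ r = p ∧ x = some s.1) ∨ ∃ k, s.2.2 = k + 1 ∧ r = k % n ∧ x = none) := by
  have hstep := stepCase hc i p
  generalize c i p = s at *
  generalize c (i + 1) p = s' at *
  cases hstep with
  | none _ h' => exact absurd rfl (h' _ h)
  | invoke s v h' => rw [h] at h'; cases h'
  | ret s y h' hy => rw [h] at h'; cases h'
  | call s r' x' h' hs =>
    rw [h] at h'
    cases h'
    exact ⟨s, rfl, hs⟩
  | reply s r' y h' => rw [h] at h'; cases h'

/-- What is written into a register is the first proposal of its owner. -/
theorem write_first (hc : (registerConsensus n V).Traces e c) {i r : ℕ} {p : Fin n}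
    {a : Option V} (h : e i = some (.callReg p r (some a))) :
    r = p ∧ ∃ v, a = some v ∧ ∃ i₀ < i, First e p v i₀ := by
  obtain ⟨s, hs, -, ⟨-, hr, hx⟩ | ⟨-, -, -, hx⟩⟩ := call_cases hc h
  · cases hx
    refine ⟨hr, ?_⟩
    obtain ⟨h1, h2⟩ := first_of_loc hc i p
    rw [hs] at h1 h2
    rcases hv : s.1 with _ | v
    · cases (h1 hv).1
    · exact ⟨v, rfl, h2 v hv⟩
  · cases hx

/-- Only one value is ever written into a register. -/
theorem exists_written (hc : (registerConsensus n V).Traces e c) (r : ℕ) :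
    ∃ u : Option V, ∀ (i : ℕ) (q : Fin n) (a : Option V),
      (registerConsensus n V).regHistory e r i = some (.inv q (some a)) → a = u := by
  by_cases h : ∃ (i : ℕ) (q : Fin n) (a : Option V),
      (registerConsensus n V).regHistory e r i = some (.inv q (some a))
  · obtain ⟨i, q, a, h⟩ := h
    obtain ⟨hq, v, rfl, i₀, -, hv⟩ := write_first hc (Implementation.of_regHistory_inv h)
    refine ⟨some v, fun i' q' a' h' => ?_⟩
    obtain ⟨hq', v', rfl, i₀', -, hv'⟩ := write_first hc (Implementation.of_regHistory_inv h')
    obtain rfl : q = q' := Fin.ext (by omega)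
    rw [hv.unique hv']
  · push Not at h
    exact ⟨none, fun i q a h' => absurd h' (h i q a)⟩

/-- The call that belongs to the answer of a register. -/
theorem reply_cases (hc : (registerConsensus n V).Traces e c) {t r : ℕ} {p : Fin n} {s : Loc V}
    {y : Option (Option V)} (hs : c t p = (.waitReg r, s)) (h : e t = some (.replyReg p r y)) :
    ∃ i < t, (∀ k, i < k → k < t → ∀ ev, e k = some ev → ev.proc ≠ p) ∧
      ((registerConsensus n V).regHistory e r).Returns i t y ∧ s.2.1 = none ∧
      ((s.2.2 = 0 ∧ r = p ∧
          (registerConsensus n V).regHistory e r i = some (.inv p (some s.1))) ∨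
        ∃ k, s.2.2 = k + 1 ∧ r = k % n ∧
          (registerConsensus n V).regHistory e r i = some (.inv p none)) := by
  obtain ⟨i, hi, x, hx, -, ha, hb⟩ := hc.exists_callReg hs
  have hinv := Implementation.regHistory_callReg hx
  refine ⟨i, hi, hb, ⟨p, x, hinv, hi, Implementation.regHistory_replyReg h, ?_⟩, ?_⟩
  · intro k h1 h2 ev hev
    obtain ⟨ev', h3, h4⟩ := Implementation.proc_of_regHistory hev
    rw [← h4]
    exact hb k h1 h2 ev' h3
  · obtain ⟨h1, ⟨h2, h3, rfl⟩ | ⟨k, h2, h3, rfl⟩⟩ := action_eq_reg ha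
    · exact ⟨h1, .inl ⟨h2, h3, hinv⟩⟩
    · exact ⟨h1, .inr ⟨k, h2, h3, hinv⟩⟩

theorem found_of_ret (hc : (registerConsensus n V).Traces e c) {i : ℕ} {p : Fin n} {y : V}
    (h : e i = some (.ret p y)) : (c i p).2.2.1 = some y := by
  have hstep := stepCase hc i p
  generalize c i p = s at *
  generalize c (i + 1) p = s' at *
  cases hstep with
  | none _ h' => exact absurd rfl (h' _ h)
  | invoke s v h' => rw [h] at h'; cases h'
  | ret s y h' hy =>
    rw [h] at h'
    cases h'
    exact hy
  | call s r x h' hs => rw [h] at h'; cases h'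
  | reply s r y h' => rw [h] at h'; cases h'

/-- Every value that is found is the first proposal of a process. -/
theorem first_of_found (hc : (registerConsensus n V).Traces e c)
    (hreg : ∀ r, ((registerConsensus n V).regHistory e r).Linearizable) (t : ℕ) (p : Fin n)
    (y : V) (hy : (c t p).2.2.1 = some y) : ∃ i < t, ∃ q, First e q y i := by
  induction t with
  | zero =>
    have h : c 0 p = (.idle, none, none, 0) := hc.zero p
    rw [h] at hy
    cases hy
  | succ t ih =>
    have hstep := stepCase hc t p
    have hreply := fun r s y => reply_cases (e := e) (t := t) (r := r) (p := p) (s := s) (y := y) hc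
    generalize c t p = s at *
    generalize c (t + 1) p = s' at *
    have later : s.2.2.1 = some y → ∃ i < t + 1, ∃ q, First e q y i := fun hv => by
      obtain ⟨i, hi, h⟩ := ih hv
      exact ⟨i, by omega, h⟩
    cases hstep with
    | none _ h => exact later hy
    | invoke s v h => cases hy
    | ret s y h hy' => exact later hy
    | call s r x h hs => exact later hy
    | reply s r y' h =>
      obtain ⟨i, hi, -, hret, -, hcase⟩ := hreply r s y' rfl h
      obtain ⟨u, hu⟩ := exists_written hc r
      obtain ⟨h1, h2, -, -⟩ := (hreg r).writeOnce hu
      rcases hcase with ⟨-, -, hinv⟩ | ⟨k, -, -, hinv⟩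
      · obtain rfl := h2 _ _ _ _ _ hret hinv
        cases hy
      · rcases h1 _ _ _ _ hret hinv with rfl | ⟨rfl, i', hi', q', hw⟩
        · cases hy
        · obtain ⟨-, v, hv, i₀, hi₀, hfirst⟩ :=
            write_first hc (Implementation.of_regHistory_inv hw)
          obtain rfl : u = some y := hy
          cases hv
          exact ⟨i₀, by omega, q', hfirst⟩

/-- A process does not get beyond its own register. -/
theorem access_bound (hc : (registerConsensus n V).Traces e c)
    (hreg : ∀ r, ((registerConsensus n V).regHistory e r).Linearizable) (t : ℕ) (p : Fin n)
    (hidle : (c t p).1 ≠ .idle) :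
    (0 < (c t p).2.2.2 → ∃ i j a, ∃ y : Option (Option V), j < t ∧
      ((registerConsensus n V).regHistory e p).Returns i j y ∧
      (registerConsensus n V).regHistory e p i = some (.inv p (some a))) ∧
    ((c t p).2.2.1 = none → (c t p).2.2.2 ≤ p + 1) ∧ (c t p).2.2.2 ≤ p + 2 := by
  induction t with
  | zero =>
    have h : c 0 p = (.idle, none, none, 0) := hc.zero p
    rw [h] at hidle
    exact absurd rfl hidle
  | succ t ih =>
    have hstep := stepCase hc t p
    have hreply := fun r s y => reply_cases (e := e) (t := t) (r := r) (p := p) (s := s) (y := y) hc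
    generalize c t p = s at *
    generalize c (t + 1) p = s' at *
    have later : ∀ {s : Status × Loc V}, (0 < s.2.2.2 → ∃ i j a, ∃ y : Option (Option V), j < t ∧
        ((registerConsensus n V).regHistory e p).Returns i j y ∧
        (registerConsensus n V).regHistory e p i = some (.inv p (some a))) →
        (0 < s.2.2.2 → ∃ i j a, ∃ y : Option (Option V), j < t + 1 ∧
        ((registerConsensus n V).regHistory e p).Returns i j y ∧
        (registerConsensus n V).regHistory e p i = some (.inv p (some a))) := fun h h' => by
      obtain ⟨i, j, a, y, hj, h⟩ := h h'
      exact ⟨i, j, a, y, by omega, h⟩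
    cases hstep with
    | none _ h =>
      obtain ⟨h1, h2⟩ := ih hidle
      exact ⟨later h1, h2⟩
    | invoke s v h => exact ⟨fun h => absurd h (lt_irrefl _), fun _ => Nat.zero_le _, Nat.zero_le _⟩
    | ret s y h hy => exact absurd rfl hidle
    | call s r x h hs =>
      obtain ⟨h1, h2⟩ := ih (by simp)
      exact ⟨later (s := (.running, s)) h1, h2⟩
    | reply s r y h =>
      obtain ⟨h1, h2, h3⟩ := ih (by simp)
      obtain ⟨i, hi, hb, hret, hnone, hcase⟩ := hreply r s y rfl h
      have h2 := h2 hnone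
      simp only at h2 h1
      rcases hcase with ⟨hk, rfl, hinv⟩ | ⟨k, hk, hr, hinv⟩
      · refine ⟨fun _ => ⟨i, t, _, y, by omega, hret, hinv⟩, fun _ => ?_, ?_⟩ <;>
          simp only [hk] <;> omega
      -- A positive count means that the write to the own register has returned. If nothing were
      -- found after reading register `p`, that read, which follows the completed write, would have
      -- returned the written value. So at most one write and `p + 1` reads occur.
      · have hwrite := h1 (by omega)
        refine ⟨later (s := (.waitReg r, s.1, y.bind id, s.2.2 + 1)) fun _ => hwrite,
          fun hy => ?_, by simp only; omega⟩
        simp only at hy ⊢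
        by_contra hcon
        obtain rfl : k = p := by omega
        rw [Nat.mod_eq_of_lt p.2] at hr
        subst hr
        obtain ⟨iw, jw, a, yw, hjw, hretw, hinvw⟩ := hwrite
        obtain ⟨u, hu⟩ := exists_written hc (p : ℕ)
        obtain ⟨-, -, h4, -⟩ := (hreg p).writeOnce hu
        have hlt : jw < i := by
          obtain ⟨q, x, hq, -, hres, -⟩ := hretw
          rw [hinvw] at hq
          cases hq
          obtain ⟨ev', hev', hproc⟩ := Implementation.proc_of_regHistory hres
          rcases lt_trichotomy jw i with h5 | rfl | h5
          · exact h5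
          · rw [hinv] at hres
            cases hres
          · exact absurd hproc (hb jw h5 hjw ev' hev')
        have h5 := h4 _ _ _ _ _ _ _ _ _ hretw hinvw hret hinv hlt
        obtain ⟨-, v, rfl, -⟩ := write_first hc (Implementation.of_regHistory_inv hinvw)
        rw [h5, ← hu _ _ _ hinvw] at hy
        cases hy

theorem waitFree : (registerConsensus n V).WaitFree := by
  intro e he i p x hi
  obtain ⟨c, hc⟩ := he.follows.exists_traces
  by_contra hcon
  push Not at hcon
  obtain ⟨hret, hinf⟩ := hcon
  have hbusy : ∀ t, i + 1 ≤ t → (c t p).1 ≠ .idle := by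
    intro t ht
    induction t, ht using Nat.le_induction with
    | base =>
      have hstep := stepCase hc i p
      generalize c i p = s at *
      generalize c (i + 1) p = s' at *
      cases hstep with
      | none _ h => exact absurd rfl (h _ hi)
      | invoke s v h => simp
      | ret s y h hy => rw [hi] at h; cases h
      | call s r x h hs => rw [hi] at h; cases h
      | reply s r y h => rw [hi] at h; cases h
    | succ t ht ih =>
      have hstep := stepCase hc t p
      generalize c t p = s at *
      generalize c (t + 1) p = s' at *
      cases hstep with
      | none _ h => exact ih
      | invoke s v h => simp
      | ret s y h hy => exact absurd h (hret t y (by omega))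
      | call s r x h hs => simp
      | reply s r y h => simp
  -- Calls and replies each raise `μ` by one, so every step of a pending operation increases it,
  -- while `access_bound` keeps it at most `2 * (p + 2) + 1`.
  let μ : Status × Loc V → ℕ := fun s =>
    2 * s.2.2.2 + (match s.1 with | .waitReg _ => 1 | _ => 0)
  have hμ : ∀ t, i + 1 ≤ t → μ (c t p) ≤ μ (c (t + 1) p) ∧
      ∀ ev, e t = some ev → ev.proc = p → μ (c t p) < μ (c (t + 1) p) := by
    intro t ht
    have hb := hbusy t ht
    have hstep := stepCase hc t p
    generalize c t p = s at *
    generalize c (t + 1) p = s' at *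
    cases hstep with
    | none _ h => exact ⟨le_rfl, fun ev hev hp => absurd hp (h ev hev)⟩
    | invoke s v h => exact absurd rfl hb
    | ret s y h hy => exact absurd h (hret t y (by omega))
    | call s r x h hs => exact ⟨by simp [μ], fun _ _ _ => by simp [μ]⟩
    | reply s r y h =>
      refine ⟨?_, fun _ _ _ => ?_⟩ <;> simp only [μ] <;> omega
  have hmono : ∀ t t', i + 1 ≤ t → t ≤ t' → μ (c t p) ≤ μ (c t' p) := by
    intro t t' ht htt'
    induction t', htt' using Nat.le_induction with
    | base => exact le_rfl
    | succ t' h ih => exact ih.trans (hμ t' (by omega)).1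
  have hunb : ∀ N, ∃ t, i + 1 ≤ t ∧ N ≤ μ (c t p) := by
    intro N
    induction N with
    | zero => exact ⟨i + 1, le_rfl, Nat.zero_le _⟩
    | succ N ih =>
      obtain ⟨t, ht, hN⟩ := ih
      obtain ⟨j, hj, ev, hev, hp⟩ := hinf t
      refine ⟨j + 1, by omega, ?_⟩
      have h1 := hmono t j ht hj
      have h2 := (hμ j (by omega)).2 ev hev hp
      omega
  obtain ⟨t, ht, hN⟩ := hunb (2 * (p + 2) + 2)
  have hbound := (access_bound hc he.registers t p (hbusy t ht)).2.2
  have : μ (c t p) ≤ 2 * (c t p).2.2.2 + 1 := by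
    simp only [μ]
    split <;> omega
  omega

/-- What an operation finds that is invoked when all registers are stable. -/
theorem found_of_stable (hc : (registerConsensus n V).Traces e c) {M : ℕ} {b : ℕ → Option V}
    (hstable : ∀ r < n, ∀ (i j : ℕ) (q : Fin n) (y : Option (Option V)),
      ((registerConsensus n V).regHistory e r).Returns i j y →
      (registerConsensus n V).regHistory e r i = some (.inv q none) → M ≤ i → y = some (b r))
    (hwrite : ∀ (r i j : ℕ) (q : Fin n) (a : Option V) (y : Option (Option V)),
      ((registerConsensus n V).regHistory e r).Returns i j y →
      (registerConsensus n V).regHistory e r i = some (.inv q (some a)) → y = none)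
    {i j : ℕ} {y : V} (hr : ((registerConsensus n V).history e).Returns i j y) (hM : M ≤ i) :
    ∃ m, b (m % n) = some y ∧ ∀ r < m, b (r % n) = none := by
  obtain ⟨p, x, hi, hij, hj, hbetween⟩ := hr
  replace hi := Implementation.of_history_inv hi
  replace hj := Implementation.of_history_res hj
  -- While nothing is found, the registers scanned so far are stably empty; the index is `r + 1`
  -- because access 0 is the write. A value that is found is therefore the first stable one in scan
  -- order.
  have key : ∀ t, i + 1 ≤ t → t ≤ j → (c t p).1 ≠ .idle ∧
      ((c t p).2.2.1 = none → ∀ r, r + 1 < (c t p).2.2.2 → b (r % n) = none) ∧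
      (∀ y, (c t p).2.2.1 = some y → ∃ m, b (m % n) = some y ∧ ∀ r < m, b (r % n) = none) := by
    intro t ht
    induction t, ht using Nat.le_induction with
    | base =>
      intro _
      have hstep := stepCase hc i p
      generalize c i p = s at *
      generalize c (i + 1) p = s' at *
      cases hstep with
      | none _ h => exact absurd rfl (h _ hi)
      | invoke s v h => exact ⟨by simp, fun _ r hr => by simp at hr, fun y hy => by cases hy⟩
      | ret s y h hy => rw [hi] at h; cases h
      | call s r x h hs => rw [hi] at h; cases h
      | reply s r y h => rw [hi] at h; cases h
    | succ t ht ih =>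
      intro htj
      obtain ⟨hb, ih1, ih2⟩ := ih (by omega)
      have hstep := stepCase hc t p
      have hreply := fun r s y =>
        reply_cases (e := e) (t := t) (r := r) (p := p) (s := s) (y := y) hc
      generalize c t p = s at *
      generalize c (t + 1) p = s' at *
      cases hstep with
      | none _ h => exact ⟨hb, ih1, ih2⟩
      | invoke s v h => exact absurd rfl hb
      | ret s y h hy =>
        refine absurd rfl (hbetween t (by omega) (by omega) (.res p y) ?_)
        simp only [Implementation.history, h]
      | call s r x h hs => exact ⟨by simp, ih1, ih2⟩
      | reply s r y h =>
        obtain ⟨i', hi', hquiet, hret, hnone, hcase⟩ := hreply r s y rfl h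
        replace ih1 := ih1 hnone
        simp only at ih1
        rcases hcase with ⟨hk, rfl, hinv⟩ | ⟨k, hk, hr, hinv⟩
        · obtain rfl := hwrite _ _ _ _ _ _ hret hinv
          refine ⟨by simp, fun _ r hr => ?_, fun y hy => by cases hy⟩
          simp [hk] at hr
        -- The process takes no step between a call and its reply, so this call was issued within
        -- the present operation, hence after `M`.
        · have hii' : i < i' := by
            rcases lt_trichotomy i i' with h5 | rfl | h5
            · exact h5
            · have := Implementation.of_regHistory_inv hinv
              rw [hi] at this
              cases this
            · exact absurd rfl (hquiet i h5 (by omega) _ hi)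
          have hn : 0 < n := p.pos
          obtain rfl := hstable r (hr ▸ Nat.mod_lt _ hn) _ _ _ _ hret hinv (by omega)
          subst hr
          refine ⟨by simp, fun hy r hr => ?_, fun y hy => ⟨k, hy, fun r hr => ih1 r (by omega)⟩⟩
          simp only at hr
          rcases Nat.lt_succ_iff_lt_or_eq.1 (show r < k + 1 by omega) with h6 | rfl
          · exact ih1 r (by omega)
          · exact hy
  exact (key j hij le_rfl).2.2 y (found_of_ret hc hj)

/-- Found values are first proposals, which gives weak consistency. Operations that return late are
invoked late, when all `n` registers are stable; scanning in the same order, they stop at the same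
register. -/
theorem eventuallyLinearizable : (registerConsensus n V).EventuallyLinearizable := by
  intro e he
  obtain ⟨c, hc⟩ := he.follows.exists_traces
  apply History.eventuallyLinearizable_of_decided
  · intro i j y p x hr hi
    obtain ⟨q, x', hi', hij, hj, -⟩ := hr
    rw [hi] at hi'
    obtain ⟨rfl, rfl⟩ := ObjEvent.inv.inj (Option.some.inj hi')
    replace hj := Implementation.of_history_res hj
    obtain ⟨i₀, hi₀, q, hq, hfirst⟩ := first_of_found hc he.registers j p y (found_of_ret hc hj)
    refine ⟨i₀, hi₀, q, by simp only [Implementation.history, hq], ?_⟩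
    rintro rfl i' hlt x' hx'
    replace hi := Implementation.of_history_inv hi
    rw [hq] at hi
    cases hi
    exact hfirst i' hlt x' (Implementation.of_history_inv hx')
  · choose u hu using exists_written hc
    choose b M hM using fun r => ((he.registers r).writeOnce (hu r)).2.2.2
    obtain ⟨M', hM'⟩ := History.exists_late_return ((registerConsensus n V).history e)
      ((Finset.range n).sup M)
    have hfound : ∀ (i j : ℕ) (y : V), ((registerConsensus n V).history e).Returns i j y →
        M' ≤ j → ∃ m, b (m % n) = some y ∧ ∀ r < m, b (r % n) = none := fun i j y hr hj =>
      found_of_stable hc (b := b) (M := (Finset.range n).sup M)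
        (fun r hr i j q y hret hinv hle => hM r i j q y hret hinv
          (le_trans (Finset.le_sup (f := M) (Finset.mem_range.2 hr)) hle))
        (fun r => ((he.registers r).writeOnce (hu r)).2.1) hr (hM' i j y hr hj)
    refine ⟨M', fun i j i' j' y y' hr hr' hj hj' => ?_⟩
    obtain ⟨m, hm, hlt⟩ := hfound i j y hr hj
    obtain ⟨m', hm', hlt'⟩ := hfound i' j' y' hr' hj'
    rcases lt_trichotomy m m' with h | rfl | h
    · rw [hlt' m h] at hm
      cases hm
    · rw [hm] at hm'
      exact Option.some.inj hm'
    · rw [hlt m' h] at hm'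
      cases hm'

theorem usesRegistersBelow : (registerConsensus n V).UsesRegistersBelow n := by
  intro p s k x h
  obtain ⟨-, ⟨-, rfl, -⟩ | ⟨k', -, rfl, -⟩⟩ := action_eq_reg h
  · exact p.2
  · exact Nat.mod_lt _ p.pos

end registerConsensus

theorem eventuallyImplementsFromRegisters_consensus (n : ℕ) (V : Type) [Primcodable V] :
    EventuallyImplementsFromRegisters n (DataType.consensus V) :=
  ⟨registerConsensus n V, registerConsensus.waitFree, registerConsensus.eventuallyLinearizable,
    n, registerConsensus.usesRegistersBelow⟩

theorem eventualConsensusNumber_consensus (V W : Type) [Primcodable V] [Primcodable W]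
    [Nonempty W] : eventualConsensusNumber W (DataType.consensus V) = 1 := by
  apply le_antisymm
  · refine sSup_le ?_
    rintro _ ⟨n, rfl, hn⟩
    by_contra hcon
    refine not_eventuallyImplements_of_two_le (n := n) ?_ V W hn
    have : ¬ n ≤ 1 := fun h => hcon (by exact_mod_cast h)
    omega
  · exact le_sSup ⟨1, by simp, eventuallyImplements_one W V⟩

theorem theorem14 (V W : Type) [Primcodable V] [Primcodable W] [Nonempty W] :
    eventualConsensusNumber W (DataType.consensus V) = 1 ∧
      ∀ n : ℕ, EventuallyImplementsFromRegisters n (DataType.consensus V) :=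
  ⟨eventualConsensusNumber_consensus V W,
    fun n => eventuallyImplementsFromRegisters_consensus n V⟩
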